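/- Let $\mathbb T=\mathbb R/\mathbb Z$, let $\omega\subset\mathbb T$ be a nonempty open set and let $T>0$. A solution on $[0,T]$ of $i\partial_t u+\partial_x^2u=g$, with $g\in L^1([0,T],L^2(\mathbb T))$, means a function $u\in C([0,T],L^2(\mathbb T))$ such that for every $\varphi\in C^\infty(\mathbb T)$ and $t\in[0,T]$ $$i\int_{\mathbb T}(u(t)-u(0))\varphi\,dx+\int_0^t\!\int_{\mathbb T}u(s)\,\partial_x^2\varphi\,dx\,ds=\int_0^t\!\int_{\mathbb T}g(s)\,\varphi\,dx\,ds .$$ (i) For all $u_0,u_1\in L^2(\mathbb T)$ there exists a control $g\in L^\infty([0,T],L^2(\mathbb T))$ supported in $[0,T]\times\omega$ (that is, for almost every $t\in[0,T]$, $g(t)=0$ almost everywhere on $\mathbb T\setminus\omega$) such that the equation $$i\partial_tu+\partial_x^2u=g,\qquad u(0)=u_0$$ has a unique solution $u$ on $[0,T]$, and this solution satisfies $u(T)=u_1$. (ii) For $\Phi_0\in L^2(\mathbb T)$, let $\Phi$ be the solution of $i\partial_t\Phi+\partial_x^2\Phi=0$, $\Phi(0)=\Phi_0$, let $\Psi$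 be the solution of $i\partial_t\Psi+\partial_x^2\Psi=1_\omega\Phi$, $\Psi(T)=0$, and put $S\Phi_0=-i\Psi(0)$. Then $S$ is a well-defined bounded linear operator on $L^2(\mathbb T)$; it is self-adjoint, positive ($\langle S\Phi_0,\Phi_0\rangle_{L^2}>0$ for $\Phi_0\neq0$), and an isomorphism of $L^2(\mathbb T)$ onto itself. -/

import Mathlib

open MeasureTheory Set

noncomputable section

/-- The space `L²(𝕋)` of complex-valued functions on `𝕋 = ℝ/ℤ`. The Haar measure of total mass `1`
is the Lebesgue measure of `ℝ/ℤ`. -/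
abbrev L2Torus : Type := Lp ℂ 2 (AddCircle.haarAddCircle (T := (1 : ℝ)))

/-- The (bilinear) pairing `∫_𝕋 u φ dx` of `u ∈ L²(𝕋)` with a `1`-periodic function `φ` on `ℝ`. -/
def torusPairing (u : L2Torus) (φ : ℝ → ℂ) : ℂ :=
  ∫ x in (0 : ℝ)..1, u (x : UnitAddCircle) * φ x

/-- `u` is a (weak) solution of `i ∂ₜu + ∂ₓ²u = g` on `[0,T] × 𝕋` in the class `C([0,T], L²(𝕋))`,
for a source `g ∈ L¹([0,T], L²(𝕋))`: the equation, integrated in time, holds against every smooth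
function on `𝕋` (that is, every smooth `1`-periodic function on `ℝ`). -/
structure IsSchrodingerSolution (T : ℝ) (g u : ℝ → L2Torus) : Prop where
  source_integrable : IntegrableOn g (Icc 0 T)
  continuousOn : ContinuousOn u (Icc 0 T)
  equation : ∀ φ : ℝ → ℂ, ContDiff ℝ ((⊤ : ℕ∞) : WithTop ℕ∞) φ → Function.Periodic φ 1 → ∀ t ∈ Icc 0 T,
    Complex.I * (torusPairing (u t) φ - torusPairing (u 0) φ)
        + ∫ s in (0 : ℝ)..t, torusPairing (u s) (iteratedDeriv 2 φ)
      = ∫ s in (0 : ℝ)..t, torusPairing (g s) φ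

/-- The function `1_ω u`. -/
def restrictTo (ω : Set UnitAddCircle) (hω : IsOpen ω) (u : L2Torus) : L2Torus :=
  ((Lp.memLp u).indicator hω.measurableSet).toLp (ω.indicator u)

/-- `Φ` is a solution of the free equation `i ∂ₜΦ + ∂ₓ²Φ = 0` on `[0,T]`, and `Ψ` solves
`i ∂ₜΨ + ∂ₓ²Ψ = 1_ω Φ` on `[0,T]` with `Ψ(T) = 0`. -/
structure IsDualControlPair (ω : Set UnitAddCircle) (hω : IsOpen ω) (T : ℝ)
    (Φ Ψ : ℝ → L2Torus) : Prop where
  free : IsSchrodingerSolution T (fun _ => 0) Φ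
  controlled : IsSchrodingerSolution T (fun t => restrictTo ω hω (Φ t)) Ψ
  final : Ψ T = 0

end

/-! ### Oscillatory integrals -/

/-! The proof is the Hilbert uniqueness method. Write U(t) = exp(it∂ₓ²) and S = ∫₀ᵀ U(-s) 1_ω U(s)
ds. By Duhamel's formula the source 1_ω U(s)f drives u₀ to U(T)(u₀ - iSf), so exact controllability
amounts to solving Sf = i(U(-T)u₁ - u₀), and uniqueness of weak solutions identifies S with the map
Φ(0) ↦ -iΨ(0). The operator S is symmetric with ⟨Su, u⟩ = ∫₀ᵀ ‖1_ω U(s)u‖² ds, so everything follows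
once this form is coercive, which is observability (`exists_observability`).

For observability, collect the modes n = ±k, which share the frequency (2πk)². If P_k is the
projection onto their span, then 1_ω U(t)u = ∑ₖ exp(-i(2πk)²t) f_k with f_k = 1_ω P_k u. Two
estimates then suffice. In time, Ingham's inequality for L²-valued sums (`inghamBound_zero`) bounds
the energy below by c ∑ₖ ‖f_k‖²; it holds for every T > 0 because the frequency gaps grow. In space,
`norm_restrictTo_eigenfunction_sq_ge` gives ‖f_k‖² ≥ d ‖P_k u‖² with d independent of k, since
exp(2πikx) and exp(-2πikx) are uniformly independent on any interval.

Ingham's inequality is obtained for high frequencies from a weight vanishing at the ends of the time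
interval; the finitely many low frequencies are then restored one by one, each at the cost of an
arbitrarily small increase of the time. -/

theorem abs_sin_le_of_le {z₀ : ℝ} (hz₀ : 0 < z₀) :
    ∃ d : ℝ, 0 < d ∧ ∀ z : ℝ, z₀ ≤ |z| → |Real.sin z| ≤ (1 - d) * |z| := by
  -- Beyond 2 the bound |sin z| ≤ 1 suffices; between z₀ and 2 the half-angle formula gains the
  -- factor cos(z/2) ≤ cos w < 1.
  set w := min z₀ 2 / 2 with hw
  have hw0 : 0 < w := by positivity
  have hw1 : w ≤ 1 := by
    have := min_le_right z₀ 2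
    rw [hw]; linarith
  have hpi := Real.pi_gt_three
  have hcos : Real.cos w < 1 := by
    have := Real.cos_lt_cos_of_nonneg_of_le_pi (x := 0) (y := w) le_rfl (by linarith) hw0
    simpa using this
  refine ⟨min (1 / 2) (1 - Real.cos w), lt_min (by norm_num) (by linarith), ?_⟩
  have key : ∀ z : ℝ, z₀ ≤ z → |Real.sin z| ≤ (1 - min (1 / 2) (1 - Real.cos w)) * z := by
    intro z hz
    have hzpos : 0 < z := lt_of_lt_of_le hz₀ hz
    rcases le_total 2 z with h2 | h2
    · have h1 := Real.abs_sin_le_one z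
      have h3 := min_le_left (1 / 2) (1 - Real.cos w)
      nlinarith
    · have h3 := min_le_right (1 / 2) (1 - Real.cos w)
      have h4 : Real.sin z = 2 * Real.sin (z / 2) * Real.cos (z / 2) := by
        rw [← Real.sin_two_mul]; congr 1; ring
      have h5 : Real.cos (z / 2) ≤ Real.cos w := by
        apply Real.cos_le_cos_of_nonneg_of_le_pi hw0.le (by linarith)
        have := min_le_left z₀ 2
        rw [hw]; linarith
      have h6 : 0 ≤ Real.cos (z / 2) :=
        Real.cos_nonneg_of_mem_Icc ⟨by linarith, by linarith⟩
      have h7 : Real.sin (z / 2) ≤ z / 2 := Real.sin_le (by linarith)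
      have h8 : 0 ≤ Real.sin (z / 2) := Real.sin_nonneg_of_nonneg_of_le_pi (by linarith) (by linarith)
      rw [h4, abs_of_nonneg (by positivity)]
      nlinarith
  intro z hz
  rcases le_total 0 z with h | h
  · rw [abs_of_nonneg h] at hz ⊢
    exact key z hz
  · rw [abs_of_nonpos h] at hz ⊢
    simpa using key (-z) hz

/-- The modulus is 2|sin(βl/2)|/|β|. The gain over the trivial bound l is uniform in β; it serves
both to separate frequencies in time and to separate the modes ±k in space. -/
theorem norm_integral_exp_le {l β₀ : ℝ} (hl : 0 < l) (hβ₀ : 0 < β₀) :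
    ∃ d : ℝ, 0 < d ∧ ∀ β : ℝ, β₀ ≤ |β| → ∀ a : ℝ,
      ‖∫ x in a..(a + l), Complex.exp (Complex.I * β * x)‖ ≤ (1 - d) * l := by
  obtain ⟨d, hd, h⟩ := abs_sin_le_of_le (z₀ := β₀ * l / 2) (by positivity)
  refine ⟨d, hd, fun β hβ a => ?_⟩
  have hβ' : 0 < |β| := lt_of_lt_of_le hβ₀ hβ
  have hβ0 : β ≠ 0 := abs_pos.mp hβ'
  rw [integral_exp_mul_complex (by simp [hβ0])]
  have h1 : Complex.exp (Complex.I * β * ((a + l : ℝ) : ℂ)) - Complex.exp (Complex.I * β * (a : ℝ))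
      = Complex.exp (Complex.I * ((β * a : ℝ) : ℂ)) *
        (Complex.exp (Complex.I * ((β * l : ℝ) : ℂ)) - 1) := by
    rw [mul_sub, ← Complex.exp_add]
    push_cast
    congr 2 <;> ring_nf
  rw [h1, norm_div, norm_mul, Complex.norm_exp_I_mul_ofReal, Complex.norm_exp_I_mul_ofReal_sub_one]
  have h2 := h (β * l / 2) (by rw [abs_div, abs_mul, abs_of_pos hl, abs_of_pos (by norm_num : (0:ℝ) < 2)]; gcongr)
  rw [abs_div, abs_mul, abs_of_pos hl, abs_of_pos (by norm_num : (0:ℝ) < 2)] at h2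
  simp only [norm_mul, Complex.norm_I, Complex.norm_real, Real.norm_eq_abs, one_mul]
  rw [div_le_iff₀ hβ', abs_of_pos (by norm_num : (0:ℝ) < 2)]
  linarith

theorem integral_quadratic_mul_exp (a b : ℝ) {c : ℂ} (hc : c ≠ 0) :
    ∫ t in a..b, (((t - a) * (b - t) : ℝ) : ℂ) * Complex.exp (c * t) =
      Complex.exp (c * b) * ((b - a) / c ^ 2 - 2 / c ^ 3) +
        Complex.exp (c * a) * ((b - a) / c ^ 2 + 2 / c ^ 3) := by
  have hderiv : ∀ t ∈ uIcc a b, HasDerivAt (fun t : ℝ => Complex.exp (c * t) *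
      (((t : ℂ) - a) * (b - t) / c - (a + b - 2 * t) / c ^ 2 - 2 / c ^ 3))
      ((((t - a) * (b - t) : ℝ) : ℂ) * Complex.exp (c * t)) t := by
    intro t _
    have h0 : HasDerivAt (fun t : ℝ => (t : ℂ)) 1 t := Complex.ofRealCLM.hasDerivAt
    have h1 : HasDerivAt (fun t : ℝ => Complex.exp (c * t)) (Complex.exp (c * t) * (c * 1)) t :=
      (h0.const_mul c).cexp
    have h2 : HasDerivAt (fun t : ℝ => ((t : ℂ) - a) * (b - t) / c - (a + b - 2 * t) / c ^ 2 - 2 / c ^ 3)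
        ((1 * ((b : ℂ) - t) + ((t : ℂ) - a) * (-1)) / c - (-(2 * 1)) / c ^ 2) t :=
      ((((h0.sub_const _).mul (h0.const_sub _)).div_const c).sub
        (((h0.const_mul 2).const_sub _).div_const _)).sub_const _
    refine (h1.mul h2).congr_deriv ?_
    push_cast
    field_simp
    ring
  rw [intervalIntegral.integral_eq_sub_of_hasDerivAt hderiv
    (Continuous.intervalIntegrable (by fun_prop) _ _)]
  field_simp
  ring

/-- Since the weight vanishes at both ends, integration by parts leaves no 1/ξ boundary term. The
resulting ξ⁻² decay is summable over the frequency differences. -/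
theorem norm_integral_quadratic_mul_exp_le {a b : ℝ} (hab : a ≤ b) {ξ : ℝ} (hξ : ξ ≠ 0) :
    ‖∫ t in a..b, (((t - a) * (b - t) : ℝ) : ℂ) * Complex.exp (Complex.I * ξ * t)‖ ≤
      4 * (b - a) / ξ ^ 2 := by
  have hc : Complex.I * ξ ≠ 0 := by simp [hξ]
  rw [integral_quadratic_mul_exp a b hc]
  have hξ' : 0 < |ξ| := abs_pos.mpr hξ
  set c : ℂ := Complex.I * ξ with hcdef
  have hcn : ‖c‖ = |ξ| := by simp [hcdef]
  have hE : ∀ x : ℝ, ‖Complex.exp (c * x)‖ = 1 := fun x => by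
    have : c * x = Complex.I * ((ξ * x : ℝ) : ℂ) := by rw [hcdef]; push_cast; ring
    rw [this, Complex.norm_exp_I_mul_ofReal]
  have hdiff : ‖Complex.exp (c * b) - Complex.exp (c * a)‖ ≤ |ξ| * (b - a) := by
    have : Complex.exp (c * b) - Complex.exp (c * a) =
        Complex.exp (c * a) * (Complex.exp (Complex.I * ((ξ * (b - a) : ℝ) : ℂ)) - 1) := by
      rw [mul_sub, ← Complex.exp_add, hcdef]
      push_cast
      congr 2 <;> ring_nf
    rw [this, norm_mul, hE, one_mul]
    refine Real.norm_exp_I_mul_ofReal_sub_one_le.trans ?_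
    rw [Real.norm_eq_abs, abs_mul, abs_of_nonneg (sub_nonneg.mpr hab)]
  -- The cubic term is paired with a difference of exponentials, of size at most |ξ|(b - a), so it
  -- too is of order (b - a)/ξ².
  have heq : Complex.exp (c * b) * ((b - a) / c ^ 2 - 2 / c ^ 3) +
        Complex.exp (c * a) * ((b - a) / c ^ 2 + 2 / c ^ 3) =
      (Complex.exp (c * b) + Complex.exp (c * a)) * (((b - a : ℝ) : ℂ) / c ^ 2) -
        (Complex.exp (c * b) - Complex.exp (c * a)) * (2 / c ^ 3) := by push_cast; ring
  rw [heq]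
  refine (norm_sub_le _ _).trans ?_
  rw [norm_mul, norm_mul, norm_div, norm_div, norm_pow, norm_pow, hcn, Complex.norm_real,
    Real.norm_eq_abs, abs_of_nonneg (sub_nonneg.mpr hab), Complex.norm_ofNat]
  have hsum : ‖Complex.exp (c * b) + Complex.exp (c * a)‖ ≤ 2 := by
    refine (norm_add_le _ _).trans ?_
    rw [hE, hE]; norm_num
  have hba : 0 ≤ b - a := sub_nonneg.mpr hab
  calc _ ≤ 2 * ((b - a) / |ξ| ^ 2) + |ξ| * (b - a) * (2 / |ξ| ^ 3) := by gcongr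
    _ = 4 * (b - a) / ξ ^ 2 := by
      rw [← sq_abs ξ]; field_simp; ring

theorem integral_quadratic (a b : ℝ) :
    ∫ t in a..b, (t - a) * (b - t) = (b - a) ^ 3 / 6 := by
  have hderiv : ∀ t ∈ uIcc a b, HasDerivAt
      (fun t : ℝ => (a + b) * t ^ 2 / 2 - t ^ 3 / 3 - a * b * t) ((t - a) * (b - t)) t := by
    intro t _
    have h0 := hasDerivAt_id' t
    refine (((((h0.pow 2).const_mul (a + b)).div_const 2).sub ((h0.pow 3).div_const 3)).sub
      (h0.const_mul (a * b))).congr_deriv ?_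
    simp
    ring
  rw [intervalIntegral.integral_eq_sub_of_hasDerivAt hderiv
    (Continuous.intervalIntegrable (by fun_prop) _ _)]
  ring

theorem norm_intervalIntegral_sq_le {E : Type*} [NormedAddCommGroup E] [NormedSpace ℝ E]
    {F : ℝ → E} (hF : Continuous F) {h : ℝ} (hh : 0 < h) :
    ‖∫ t in (0 : ℝ)..h, F t‖ ^ 2 ≤ h * ∫ t in (0 : ℝ)..h, ‖F t‖ ^ 2 := by
  have h1 := intervalIntegral.norm_integral_le_integral_norm (f := F) (μ := volume) hh.le
  set A := ∫ t in (0 : ℝ)..h, ‖F t‖ with hA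
  -- Cauchy–Schwarz, read off from the nonnegativity of the variance of ‖F‖.
  have h2 : 0 ≤ ∫ t in (0 : ℝ)..h, (‖F t‖ - A / h) ^ 2 :=
    intervalIntegral.integral_nonneg hh.le fun t _ => sq_nonneg _
  have h3 : ∫ t in (0 : ℝ)..h, (‖F t‖ - A / h) ^ 2 =
      (∫ t in (0 : ℝ)..h, ‖F t‖ ^ 2) - 2 * (A / h) * A + h * (A / h) ^ 2 := by
    have : ∀ t, (‖F t‖ - A / h) ^ 2 = ‖F t‖ ^ 2 - 2 * (A / h) * ‖F t‖ + (A / h) ^ 2 := fun t => by ring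
    simp_rw [this]
    rw [intervalIntegral.integral_add, intervalIntegral.integral_sub,
      intervalIntegral.integral_const_mul, intervalIntegral.integral_const]
    · simp [hA]
    all_goals exact Continuous.intervalIntegrable (by fun_prop) _ _
  rw [h3] at h2
  have h4 : A ^ 2 ≤ h * ∫ t in (0 : ℝ)..h, ‖F t‖ ^ 2 := by
    have : (∫ t in (0 : ℝ)..h, ‖F t‖ ^ 2) - 2 * (A / h) * A + h * (A / h) ^ 2 =
      (∫ t in (0 : ℝ)..h, ‖F t‖ ^ 2) - A ^ 2 / h := by field_simp; ring
    rw [this, sub_nonneg, div_le_iff₀ hh] at h2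
    linarith
  refine le_trans ?_ h4
  gcongr

/-! ### Ingham's inequality for vector-valued sums with quadratic frequencies -/

/-- The eigenvalue `(2πn)²` of `-∂ₓ²` on `ℝ/ℤ` for the mode `x ↦ exp(2πinx)`. -/
noncomputable def torusFreq (n : ℤ) : ℝ := (2 * Real.pi * n) ^ 2

/-- The time factor `exp(-iξt)`. -/
noncomputable def timePhase (ξ t : ℝ) : ℂ := Complex.exp (-(Complex.I * ξ * t))

theorem timePhase_eq (ξ t : ℝ) : timePhase ξ t = Complex.exp (Complex.I * ((-(ξ * t) : ℝ) : ℂ)) := by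
  rw [timePhase]; congr 1; push_cast; ring

@[simp] theorem norm_timePhase (ξ t : ℝ) : ‖timePhase ξ t‖ = 1 := by
  rw [timePhase_eq, Complex.norm_exp_I_mul_ofReal]

theorem timePhase_ne_zero (ξ t : ℝ) : timePhase ξ t ≠ 0 := Complex.exp_ne_zero _

@[simp] theorem timePhase_zero (ξ : ℝ) : timePhase ξ 0 = 1 := by simp [timePhase]

theorem timePhase_add (ξ s t : ℝ) : timePhase ξ (s + t) = timePhase ξ s * timePhase ξ t := by
  rw [timePhase, timePhase, timePhase, ← Complex.exp_add]; congr 1; push_cast; ring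

theorem conj_timePhase (ξ t : ℝ) : starRingEnd ℂ (timePhase ξ t) = timePhase ξ (-t) := by
  rw [timePhase, timePhase, ← Complex.exp_conj]; congr 1; simp

theorem conj_timePhase_mul (ξ η t : ℝ) :
    starRingEnd ℂ (timePhase ξ t) * timePhase η t =
      Complex.exp (Complex.I * ((ξ - η : ℝ) : ℂ) * t) := by
  rw [conj_timePhase, timePhase, timePhase, ← Complex.exp_add]; congr 1; push_cast; ring

theorem conj_timePhase_mul_self (ξ t : ℝ) :
    starRingEnd ℂ (timePhase ξ t) * timePhase ξ t = 1 := by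
  rw [conj_timePhase_mul]; simp

@[fun_prop] theorem continuous_timePhase (ξ : ℝ) : Continuous (timePhase ξ) := by
  unfold timePhase; fun_prop

/-- The factor m + n makes the gaps grow, which is what lets Ingham's inequality hold in arbitrarily
short time. -/
theorem abs_torusFreq_sub (m n : ℕ) :
    |torusFreq m - torusFreq n| = (2 * Real.pi) ^ 2 * (m + n) * |((m : ℤ) - n : ℤ)| := by
  have : torusFreq m - torusFreq n = (2 * Real.pi) ^ 2 * (m + n) * (((m : ℤ) - n : ℤ) : ℝ) := by
    unfold torusFreq; push_cast; ring
  rw [this, abs_mul, abs_of_nonneg (by positivity)]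
  push_cast
  rfl

theorem one_le_abs_torusFreq_sub {m n : ℕ} (h : m ≠ n) : 1 ≤ |torusFreq m - torusFreq n| := by
  rw [abs_torusFreq_sub]
  have h1 : (1 : ℝ) ≤ |((m : ℤ) - n : ℤ)| := by
    have : (1 : ℤ) ≤ |(m : ℤ) - n| := Int.one_le_abs (by omega)
    exact_mod_cast this
  have h2 : (1 : ℝ) ≤ m + n := by
    have : 1 ≤ m + n := by omega
    exact_mod_cast this
  have h3 : (1 : ℝ) ≤ (2 * Real.pi) ^ 2 := by nlinarith [Real.pi_gt_three]
  calc (1 : ℝ) = 1 * 1 * 1 := by norm_num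
    _ ≤ _ := by gcongr

section Ingham

variable {H : Type*} [NormedAddCommGroup H] [InnerProductSpace ℂ H]

/-- The function `t ↦ ∑_{k ∈ s} exp(-i(2πk)²t) f_k`. -/
noncomputable def freqSum (s : Finset ℕ) (f : ℕ → H) (t : ℝ) : H :=
  ∑ k ∈ s, timePhase (torusFreq k) t • f k

@[fun_prop] theorem continuous_freqSum (s : Finset ℕ) (f : ℕ → H) : Continuous (freqSum s f) := by
  unfold freqSum; fun_prop

theorem ofReal_norm_freqSum_sq (s : Finset ℕ) (f : ℕ → H) (t : ℝ) :
    ((‖freqSum s f t‖ ^ 2 : ℝ) : ℂ) = ∑ m ∈ s, ∑ n ∈ s,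
      Complex.exp (Complex.I * ((torusFreq m - torusFreq n : ℝ) : ℂ) * t) * inner ℂ (f m) (f n) := by
  have := inner_self_eq_norm_sq_to_K (𝕜 := ℂ) (freqSum s f t)
  rw [Complex.ofReal_pow]
  refine this.symm.trans ?_
  unfold freqSum
  rw [sum_inner]
  refine Finset.sum_congr rfl fun m _ => ?_
  rw [inner_sum]
  refine Finset.sum_congr rfl fun n _ => ?_
  rw [inner_smul_left, inner_smul_right, ← mul_assoc, conj_timePhase_mul]

/-- The term n = m, and likewise d = 0, contributes 1/0 = 0. -/
theorem sum_inv_sq_sub_le (s : Finset ℕ) (m : ℕ) :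
    ∑ n ∈ s, 1 / (((m : ℤ) - n : ℤ) : ℝ) ^ 2 ≤ ∑' d : ℤ, 1 / (d : ℝ) ^ 2 := by
  have hinj : Function.Injective (fun n : ℕ => (m : ℤ) - n) := fun a b h => by
    simp only at h; omega
  have h1 : ∑ n ∈ s, 1 / (((m : ℤ) - n : ℤ) : ℝ) ^ 2 =
      ∑ d ∈ s.map ⟨_, hinj⟩, 1 / (d : ℝ) ^ 2 := by
    rw [Finset.sum_map]; rfl
  rw [h1]
  exact (Real.summable_one_div_int_pow.mpr (by norm_num)).sum_le_tsum _ fun _ _ => by positivity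

/-- Expanding the square, the diagonal gives exactly (b - a)³/6 times the energy. Off the diagonal
the frequencies differ by at least M|m - n|, so the ξ⁻² decay of the weight's transform and a Schur
test bound the remainder. -/
theorem abs_integral_quadratic_mul_freqSum_sub_le {a b : ℝ} (hab : a ≤ b) {M : ℕ} (hM : 1 ≤ M)
    (s : Finset ℕ) (hs : ∀ m ∈ s, ∀ n ∈ s, m ≠ n → M ≤ m + n) (f : ℕ → H) :
    |(∫ t in a..b, (t - a) * (b - t) * ‖freqSum s f t‖ ^ 2) - (b - a) ^ 3 / 6 * ∑ k ∈ s, ‖f k‖ ^ 2| ≤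
      4 * (b - a) / (M : ℝ) ^ 2 * (∑' d : ℤ, 1 / (d : ℝ) ^ 2) * ∑ k ∈ s, ‖f k‖ ^ 2 := by
  set K : ℕ → ℕ → ℂ := fun m n => ∫ t in a..b, (((t - a) * (b - t) : ℝ) : ℂ) *
    Complex.exp (Complex.I * ((torusFreq m - torusFreq n : ℝ) : ℂ) * t) with hK
  set A := ∑' d : ℤ, 1 / (d : ℝ) ^ 2 with hA
  have hint : ((∫ t in a..b, (t - a) * (b - t) * ‖freqSum s f t‖ ^ 2 : ℝ) : ℂ) =
      ∑ m ∈ s, ∑ n ∈ s, K m n * inner ℂ (f m) (f n) := by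
    rw [← intervalIntegral.integral_ofReal]
    have : ∀ t : ℝ, (((t - a) * (b - t) * ‖freqSum s f t‖ ^ 2 : ℝ) : ℂ) =
        ∑ m ∈ s, ∑ n ∈ s, (((t - a) * (b - t) : ℝ) : ℂ) *
          Complex.exp (Complex.I * ((torusFreq m - torusFreq n : ℝ) : ℂ) * t) * inner ℂ (f m) (f n) := by
      intro t
      rw [Complex.ofReal_mul, ofReal_norm_freqSum_sq, Finset.mul_sum]
      refine Finset.sum_congr rfl fun m _ => ?_
      rw [Finset.mul_sum]
      exact Finset.sum_congr rfl fun n _ => by ring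
    simp_rw [this]
    rw [intervalIntegral.integral_finsetSum fun m _ => Continuous.intervalIntegrable (by fun_prop) _ _]
    refine Finset.sum_congr rfl fun m _ => ?_
    rw [intervalIntegral.integral_finsetSum fun m _ => Continuous.intervalIntegrable (by fun_prop) _ _]
    refine Finset.sum_congr rfl fun n _ => ?_
    rw [intervalIntegral.integral_mul_const]
  have hdiag : ∀ m, K m m = (((b - a) ^ 3 / 6 : ℝ) : ℂ) := by
    intro m
    simp only [hK, sub_self, Complex.ofReal_zero, mul_zero, zero_mul, Complex.exp_zero, mul_one]
    rw [intervalIntegral.integral_ofReal, integral_quadratic]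
  have hoff : ∀ m ∈ s, ∀ n ∈ s, m ≠ n →
      ‖K m n‖ ≤ 4 * (b - a) / (M : ℝ) ^ 2 * (1 / (((m : ℤ) - n : ℤ) : ℝ) ^ 2) := by
    intro m hm n hn hmn
    have h1 := one_le_abs_torusFreq_sub hmn
    have h0 : torusFreq m - torusFreq n ≠ 0 := by
      intro h; rw [h] at h1; norm_num at h1
    refine (norm_integral_quadratic_mul_exp_le hab h0).trans ?_
    have hMn : (M : ℝ) ≤ m + n := by exact_mod_cast hs m hm n hn hmn
    have hM0 : (0 : ℝ) < M := by exact_mod_cast hM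
    have hd : (0 : ℝ) < |(((m : ℤ) - n : ℤ) : ℝ)| := by
      rw [abs_pos, Int.cast_ne_zero]; omega
    have h2 : (M : ℝ) * |(((m : ℤ) - n : ℤ) : ℝ)| ≤ |torusFreq m - torusFreq n| := by
      rw [abs_torusFreq_sub]
      have h3 : (1 : ℝ) ≤ (2 * Real.pi) ^ 2 := by nlinarith [Real.pi_gt_three]
      push_cast at hd ⊢
      gcongr
      nlinarith
    have h4 : (M : ℝ) ^ 2 * (((m : ℤ) - n : ℤ) : ℝ) ^ 2 ≤ (torusFreq m - torusFreq n) ^ 2 := by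
      rw [← sq_abs (torusFreq m - torusFreq n), ← sq_abs (((m : ℤ) - n : ℤ) : ℝ), ← mul_pow]
      gcongr
    have hba : 0 ≤ b - a := sub_nonneg.mpr hab
    rw [div_mul_div_comm, mul_one]
    have : 0 < (((m : ℤ) - n : ℤ) : ℝ) ^ 2 := by rw [← sq_abs]; positivity
    gcongr
  have hsplit : (((∫ t in a..b, (t - a) * (b - t) * ‖freqSum s f t‖ ^ 2) -
      (b - a) ^ 3 / 6 * ∑ k ∈ s, ‖f k‖ ^ 2 : ℝ) : ℂ) =
      ∑ m ∈ s, ∑ n ∈ s, if m = n then 0 else K m n * inner ℂ (f m) (f n) := by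
    rw [Complex.ofReal_sub, hint, Complex.ofReal_mul, Complex.ofReal_sum, Finset.mul_sum,
      ← Finset.sum_sub_distrib]
    refine Finset.sum_congr rfl fun m hm => ?_
    have h1 : ((‖f m‖ ^ 2 : ℝ) : ℂ) = inner ℂ (f m) (f m) := by
      rw [inner_self_eq_norm_sq_to_K]; push_cast; rfl
    have h2 : (((b - a) ^ 3 / 6 : ℝ) : ℂ) * ((‖f m‖ ^ 2 : ℝ) : ℂ) =
        ∑ n ∈ s, if m = n then K m n * inner ℂ (f m) (f n) else 0 := by
      rw [Finset.sum_ite_eq, if_pos hm, hdiag, h1]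
    rw [h2, ← Finset.sum_sub_distrib]
    refine Finset.sum_congr rfl fun n _ => ?_
    split_ifs <;> simp
  rw [← Real.norm_eq_abs, ← Complex.norm_real, hsplit]
  set C := 4 * (b - a) / (M : ℝ) ^ 2 with hC
  have hC0 : 0 ≤ C := by
    have hba : 0 ≤ b - a := sub_nonneg.mpr hab
    positivity
  -- The AM-GM inequality replaces ‖f m‖‖f n‖ by squares; by symmetry only the row sums of 1/(m -
  -- n)² matter.
  have hterm : ∀ m ∈ s, ∀ n ∈ s, ‖(if m = n then 0 else K m n * inner ℂ (f m) (f n) : ℂ)‖ ≤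
      C / 2 * (1 / (((m : ℤ) - n : ℤ) : ℝ) ^ 2 * ‖f m‖ ^ 2) +
        C / 2 * (1 / (((n : ℤ) - m : ℤ) : ℝ) ^ 2 * ‖f n‖ ^ 2) := by
    intro m hm n hn
    have hsymm : (((n : ℤ) - m : ℤ) : ℝ) ^ 2 = (((m : ℤ) - n : ℤ) : ℝ) ^ 2 := by push_cast; ring
    rw [hsymm]
    split_ifs with h
    · rw [norm_zero]; positivity
    · rw [norm_mul]
      calc _ ≤ (C * (1 / (((m : ℤ) - n : ℤ) : ℝ) ^ 2)) * (‖f m‖ * ‖f n‖) :=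
            mul_le_mul (hoff m hm n hn h) (norm_inner_le_norm _ _) (norm_nonneg _) (by positivity)
        _ ≤ (C * (1 / (((m : ℤ) - n : ℤ) : ℝ) ^ 2)) * ((‖f m‖ ^ 2 + ‖f n‖ ^ 2) / 2) := by
            gcongr
            nlinarith [sq_nonneg (‖f m‖ - ‖f n‖)]
        _ = _ := by ring
  calc _ ≤ ∑ m ∈ s, ∑ n ∈ s, (C / 2 * (1 / (((m : ℤ) - n : ℤ) : ℝ) ^ 2 * ‖f m‖ ^ 2) +
        C / 2 * (1 / (((n : ℤ) - m : ℤ) : ℝ) ^ 2 * ‖f n‖ ^ 2)) := by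
        refine norm_sum_le_of_le _ fun m hm => norm_sum_le_of_le _ fun n hn => hterm m hm n hn
    _ = C * ∑ m ∈ s, (∑ n ∈ s, 1 / (((m : ℤ) - n : ℤ) : ℝ) ^ 2) * ‖f m‖ ^ 2 := by
        simp_rw [Finset.sum_add_distrib]
        rw [Finset.sum_comm (f := fun (m n : ℕ) => C / 2 * (1 / (((n : ℤ) - m : ℤ) : ℝ) ^ 2 * ‖f n‖ ^ 2)),
          ← two_mul, Finset.mul_sum, Finset.mul_sum]
        refine Finset.sum_congr rfl fun m _ => ?_
        rw [← Finset.mul_sum, ← Finset.sum_mul]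
        ring
    _ ≤ C * ∑ m ∈ s, A * ‖f m‖ ^ 2 := by
        gcongr with m _
        exact sum_inv_sq_sub_le s m
    _ = C * A * ∑ m ∈ s, ‖f m‖ ^ 2 := by rw [← Finset.mul_sum, mul_assoc]

variable (H) in
/-- Ingham's inequality on an interval of length `T` for the frequencies `(2πk)²` with `k ≥ j`. -/
def InghamBound (j : ℕ) (T : ℝ) : Prop :=
  ∃ c : ℝ, 0 < c ∧ ∀ (s : Finset ℕ) (f : ℕ → H), (∀ k ∈ s, j ≤ k) →
    c * ∑ k ∈ s, ‖f k‖ ^ 2 ≤ ∫ t in (0 : ℝ)..T, ‖freqSum s f t‖ ^ 2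

theorem exists_inghamBound {T : ℝ} (hT : 0 < T) : ∃ M : ℕ, ∀ T' ≥ T, InghamBound H M T' := by
  set A := ∑' d : ℤ, 1 / (d : ℝ) ^ 2 with hA
  -- Such an M makes the off-diagonal remainder at most T'³/12, half of the diagonal; dividing by
  -- the maximum T'²/4 of the weight leaves the constant T'/3.
  obtain ⟨M, hM⟩ := exists_nat_ge (max 1 (48 * A / T ^ 2))
  have hM1 : (1 : ℝ) ≤ M := (le_max_left _ _).trans hM
  have hM2 : 48 * A / T ^ 2 ≤ M := (le_max_right _ _).trans hM
  have hMn : 1 ≤ M := by exact_mod_cast hM1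
  have hA0 : 0 ≤ A := tsum_nonneg fun _ => by positivity
  refine ⟨M, fun T' hT' => ⟨T' / 3, by linarith, fun s f hs => ?_⟩⟩
  have hT0 : 0 < T' := by linarith
  have h1 := abs_integral_quadratic_mul_freqSum_sub_le hT0.le hMn s
    (fun m hm n _ _ => (hs m hm).trans (by omega)) f
  set E := ∑ k ∈ s, ‖f k‖ ^ 2 with hE
  have hE0 : 0 ≤ E := Finset.sum_nonneg fun _ _ => by positivity
  have h2 : (∫ t in (0 : ℝ)..T', (t - 0) * (T' - t) * ‖freqSum s f t‖ ^ 2) ≤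
      ∫ t in (0 : ℝ)..T', T' ^ 2 / 4 * ‖freqSum s f t‖ ^ 2 := by
    apply intervalIntegral.integral_mono_on hT0.le
    · exact Continuous.intervalIntegrable (by fun_prop) _ _
    · exact Continuous.intervalIntegrable (by fun_prop) _ _
    · intro t _
      gcongr
      nlinarith [sq_nonneg (t - T' / 2)]
  rw [intervalIntegral.integral_const_mul] at h2
  have h3 : 4 * (T' - 0) / (M : ℝ) ^ 2 * A ≤ T' ^ 3 / 12 := by
    rw [div_le_iff₀ (by positivity)] at hM2
    rw [div_mul_eq_mul_div, div_le_iff₀ (by positivity)]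
    have h4 : 48 * A ≤ M ^ 2 * T' ^ 2 := by
      calc 48 * A ≤ M * T ^ 2 := hM2
        _ ≤ M ^ 2 * T' ^ 2 := by
          gcongr
          nlinarith
    nlinarith
  have h5 := (abs_le.mp h1).1
  have h6 := mul_le_mul_of_nonneg_right h3 hE0
  have h7 : T' ^ 2 / 4 * (T' / 3 * E) ≤ T' ^ 2 / 4 * ∫ t in (0 : ℝ)..T', ‖freqSum s f t‖ ^ 2 := by
    rw [← hA, sub_zero] at h5
    rw [sub_zero] at h6
    nlinarith
  exact le_of_mul_le_mul_left h7 (by positivity)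

theorem exists_integral_norm_freqSum_sq_le {T : ℝ} (hT : 0 < T) :
    ∃ C : ℝ, 0 < C ∧ ∀ (s : Finset ℕ) (f : ℕ → H),
      ∫ t in (0 : ℝ)..T, ‖freqSum s f t‖ ^ 2 ≤ C * ∑ k ∈ s, ‖f k‖ ^ 2 := by
  set A := ∑' d : ℤ, 1 / (d : ℝ) ^ 2 with hA
  have hA0 : 0 ≤ A := tsum_nonneg fun _ => by positivity
  refine ⟨((3 * T) ^ 3 / 6 + 12 * T * A) / (2 * T ^ 2), by positivity, fun s f => ?_⟩
  -- On the enlarged interval [-T, 2T] the weight is at least 2T² throughout [0, T]. Here M = 1 is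
  -- allowed, because distinct naturals have sum at least 1, so no frequency is excluded.
  have h1 := abs_integral_quadratic_mul_freqSum_sub_le (a := -T) (b := 2 * T) (by linarith) le_rfl s
    (fun m hm n _ _ => by omega) f
  set E := ∑ k ∈ s, ‖f k‖ ^ 2 with hE
  have h2 : ∫ t in (0 : ℝ)..T, 2 * T ^ 2 * ‖freqSum s f t‖ ^ 2 ≤
      ∫ t in (0 : ℝ)..T, (t - -T) * (2 * T - t) * ‖freqSum s f t‖ ^ 2 := by
    apply intervalIntegral.integral_mono_on hT.le
    · exact Continuous.intervalIntegrable (by fun_prop) _ _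
    · exact Continuous.intervalIntegrable (by fun_prop) _ _
    · intro t ht
      refine mul_le_mul_of_nonneg_right ?_ (by positivity)
      nlinarith [ht.1, ht.2, mul_nonneg ht.1 (sub_nonneg.mpr ht.2)]
  have h3 : ∫ t in (0 : ℝ)..T, (t - -T) * (2 * T - t) * ‖freqSum s f t‖ ^ 2 ≤
      ∫ t in (-T)..(2 * T), (t - -T) * (2 * T - t) * ‖freqSum s f t‖ ^ 2 := by
    apply intervalIntegral.integral_mono_interval (by linarith) hT.le (by linarith)
    · refine (ae_restrict_mem measurableSet_Ioc).mono fun t ht => ?_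
      have h4 : 0 ≤ t - -T := by linarith [ht.1]
      have h5 : 0 ≤ 2 * T - t := by linarith [ht.2]
      simp only [Pi.zero_apply]
      positivity
    · exact Continuous.intervalIntegrable (by fun_prop) _ _
  rw [intervalIntegral.integral_const_mul] at h2
  have h5 := (abs_le.mp h1).2
  rw [div_mul_eq_mul_div, le_div_iff₀ (by positivity)]
  have h6 : 2 * T - -T = 3 * T := by ring
  rw [← hA, h6, Nat.cast_one, one_pow, div_one] at h5
  nlinarith

theorem InghamBound.mono {j : ℕ} {T T' : ℝ} (hT : 0 ≤ T) (hTT' : T ≤ T') (h : InghamBound H j T) :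
    InghamBound H j T' := by
  obtain ⟨c, hc, h⟩ := h
  refine ⟨c, hc, fun s f hs => (h s f hs).trans ?_⟩
  apply intervalIntegral.integral_mono_interval le_rfl hT hTT'
  · exact Filter.Eventually.of_forall fun t => by simp only [Pi.zero_apply]; positivity
  · exact Continuous.intervalIntegrable (by fun_prop) _ _

/-- Subtracting the mean of `F(t + r)` over `r ∈ [0, h]`, modulated so as to remove the mode `j`. -/
theorem freqSum_sub_mean [CompleteSpace H] (s : Finset ℕ) (f : ℕ → H) (j : ℕ) {h : ℝ} (hh : 0 < h)
    (t : ℝ) :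
    freqSum s f t - (h⁻¹ : ℂ) • ∫ r in (0 : ℝ)..h,
        starRingEnd ℂ (timePhase (torusFreq j) r) • freqSum s f (t + r) =
      freqSum (s.erase j) (fun k => (1 - (h⁻¹ : ℂ) * ∫ r in (0 : ℝ)..h,
        Complex.exp (Complex.I * ((torusFreq j - torusFreq k : ℝ) : ℂ) * r)) • f k) t := by
  have h1 : ∀ r : ℝ, starRingEnd ℂ (timePhase (torusFreq j) r) • freqSum s f (t + r) =
      ∑ k ∈ s, Complex.exp (Complex.I * ((torusFreq j - torusFreq k : ℝ) : ℂ) * r) •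
        (timePhase (torusFreq k) t • f k) := by
    intro r
    unfold freqSum
    rw [Finset.smul_sum]
    refine Finset.sum_congr rfl fun k _ => ?_
    rw [smul_smul, smul_smul, timePhase_add, ← conj_timePhase_mul]
    congr 1; ring
  simp_rw [h1]
  rw [intervalIntegral.integral_finsetSum fun m _ => Continuous.intervalIntegrable (by fun_prop) _ _]
  simp_rw [intervalIntegral.integral_smul_const]
  unfold freqSum
  rw [Finset.smul_sum, ← Finset.sum_sub_distrib]
  have h2 : ∀ k ∈ s, k ∉ s.erase j → timePhase (torusFreq k) t • f k - (h⁻¹ : ℂ) •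
      (∫ r in (0 : ℝ)..h, Complex.exp (Complex.I * ((torusFreq j - torusFreq k : ℝ) : ℂ) * r)) •
        timePhase (torusFreq k) t • f k = 0 := by
    intro k hk hk'
    have : k = j := by
      by_contra hne
      exact hk' (Finset.mem_erase.mpr ⟨hne, hk⟩)
    subst this
    have hhc : (h : ℂ) ≠ 0 := by exact_mod_cast hh.ne'
    simp [smul_smul, hhc]
  rw [← Finset.sum_subset (Finset.erase_subset j s) h2]
  refine Finset.sum_congr rfl fun k _ => ?_
  rw [smul_smul, smul_smul, smul_smul, ← sub_smul]
  congr 1; ring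

/-- Subtracting the modulated mean over a window of length h kills mode j and multiplies every other
mode by a factor of modulus at least d. The remaining modes are then controlled by the bound for j +
1, and mode j is recovered as the full sum minus the others, using the direct inequality. The window
reaches past T, whence T + h. -/
theorem InghamBound.of_succ [CompleteSpace H] {j : ℕ} {T h : ℝ} (hT : 0 < T) (hh : 0 < h)
    (hI : InghamBound H (j + 1) T) : InghamBound H j (T + h) := by
  have hI' := hI.mono hT.le (by linarith : T ≤ T + h)
  obtain ⟨c₁, hc₁, hI'⟩ := hI'
  obtain ⟨c, hc, hI⟩ := hI
  obtain ⟨d, hd, hosc⟩ := norm_integral_exp_le hh one_pos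
  obtain ⟨C, hC, hup⟩ := exists_integral_norm_freqSum_sq_le (H := H) (T := T + h) (by linarith)
  -- the modes other than `j` are controlled by `B` times the observed energy
  set B := (2 + 2 * T / h) / (c * d ^ 2) with hB
  have hB0 : 0 < B := by positivity
  have hothers : ∀ (s : Finset ℕ) (f : ℕ → H), (∀ k ∈ s, j ≤ k) →
      ∑ k ∈ s.erase j, ‖f k‖ ^ 2 ≤ B * ∫ t in (0 : ℝ)..(T + h), ‖freqSum s f t‖ ^ 2 := by
    intro s f hs
    set V := ∫ t in (0 : ℝ)..(T + h), ‖freqSum s f t‖ ^ 2 with hV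
    set g : ℕ → H := fun k => (1 - (h⁻¹ : ℂ) * ∫ r in (0 : ℝ)..h,
        Complex.exp (Complex.I * ((torusFreq j - torusFreq k : ℝ) : ℂ) * r)) • f k with hg
    have h1 : ∀ k ∈ s.erase j, j + 1 ≤ k := fun k hk => by
      have := hs k (Finset.mem_of_mem_erase hk)
      have := Finset.ne_of_mem_erase hk
      omega
    have h2 := hI (s.erase j) g h1
    have h3 : ∀ k ∈ s.erase j, d ^ 2 * ‖f k‖ ^ 2 ≤ ‖g k‖ ^ 2 := by
      intro k hk
      rw [hg, norm_smul, mul_pow]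
      have h4 := hosc (torusFreq j - torusFreq k)
        (one_le_abs_torusFreq_sub (Finset.ne_of_mem_erase hk).symm) 0
      rw [zero_add] at h4
      have h5 : d ≤ ‖1 - (h⁻¹ : ℂ) * ∫ r in (0 : ℝ)..h,
          Complex.exp (Complex.I * ((torusFreq j - torusFreq k : ℝ) : ℂ) * r)‖ := by
        have h6 := norm_sub_norm_le (1 : ℂ) ((h⁻¹ : ℂ) * ∫ r in (0 : ℝ)..h,
          Complex.exp (Complex.I * ((torusFreq j - torusFreq k : ℝ) : ℂ) * r))
        rw [norm_mul, norm_inv, Complex.norm_real, Real.norm_eq_abs, abs_of_pos hh, norm_one] at h6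
        have h7 : h⁻¹ * ‖∫ r in (0 : ℝ)..h,
          Complex.exp (Complex.I * ((torusFreq j - torusFreq k : ℝ) : ℂ) * r)‖ ≤ 1 - d := by
          rw [inv_mul_le_iff₀ hh]; linarith
        linarith
      gcongr
    have h4 : ∫ t in (0 : ℝ)..T, ‖freqSum (s.erase j) g t‖ ^ 2 ≤ (2 + 2 * T / h) * V := by
      have h5 : ∀ t ∈ Icc 0 T, ‖freqSum (s.erase j) g t‖ ^ 2 ≤
          2 * ‖freqSum s f t‖ ^ 2 + 2 / h * V := by
        intro t ht
        rw [hg, ← freqSum_sub_mean s f j hh t]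
        set J := ∫ r in (0 : ℝ)..h,
          starRingEnd ℂ (timePhase (torusFreq j) r) • freqSum s f (t + r) with hJ
        have h6 : ‖J‖ ^ 2 ≤ h * V := by
          have hcont : Continuous fun r : ℝ =>
              starRingEnd ℂ (timePhase (torusFreq j) r) • freqSum s f (t + r) := by
            simp_rw [conj_timePhase]; fun_prop
          refine (norm_intervalIntegral_sq_le hcont hh).trans ?_
          gcongr
          simp_rw [norm_smul, RCLike.norm_conj, norm_timePhase, one_mul]
          rw [intervalIntegral.integral_comp_add_left (fun r => ‖freqSum s f r‖ ^ 2) t, add_zero]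
          apply intervalIntegral.integral_mono_interval ht.1 (by linarith) (by linarith [ht.2])
          · exact Filter.Eventually.of_forall fun t => by simp only [Pi.zero_apply]; positivity
          · exact Continuous.intervalIntegrable (by fun_prop) _ _
        have h7 : ‖(h⁻¹ : ℂ) • J‖ ^ 2 ≤ V / h := by
          rw [norm_smul, norm_inv, Complex.norm_real, Real.norm_eq_abs, abs_of_pos hh, mul_pow,
            inv_pow, inv_mul_le_iff₀ (by positivity)]
          calc _ ≤ h * V := h6
            _ = h ^ 2 * (V / h) := by field_simp
        have h8 := norm_sub_le (freqSum s f t) ((h⁻¹ : ℂ) • J)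
        have h9 : ‖freqSum s f t - (h⁻¹ : ℂ) • J‖ ^ 2 ≤
            2 * ‖freqSum s f t‖ ^ 2 + 2 * ‖(h⁻¹ : ℂ) • J‖ ^ 2 := by
          have := pow_le_pow_left₀ (norm_nonneg _) h8 2
          nlinarith [sq_nonneg (‖freqSum s f t‖ - ‖(h⁻¹ : ℂ) • J‖)]
        calc _ ≤ _ := h9
          _ ≤ 2 * ‖freqSum s f t‖ ^ 2 + 2 * (V / h) := by gcongr
          _ = _ := by ring
      have h6 : ∫ t in (0 : ℝ)..T, ‖freqSum (s.erase j) g t‖ ^ 2 ≤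
          ∫ t in (0 : ℝ)..T, (2 * ‖freqSum s f t‖ ^ 2 + 2 / h * V) := by
        apply intervalIntegral.integral_mono_on hT.le
        · exact Continuous.intervalIntegrable (by fun_prop) _ _
        · exact Continuous.intervalIntegrable (by fun_prop) _ _
        · exact h5
      rw [intervalIntegral.integral_add (Continuous.intervalIntegrable (by fun_prop) _ _)
        (Continuous.intervalIntegrable (by fun_prop) _ _), intervalIntegral.integral_const_mul,
        intervalIntegral.integral_const] at h6
      have h7 : ∫ t in (0 : ℝ)..T, ‖freqSum s f t‖ ^ 2 ≤ V := by
        apply intervalIntegral.integral_mono_interval le_rfl hT.le (by linarith)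
        · exact Filter.Eventually.of_forall fun t => by simp only [Pi.zero_apply]; positivity
        · exact Continuous.intervalIntegrable (by fun_prop) _ _
      rw [smul_eq_mul, sub_zero] at h6
      calc _ ≤ _ := h6
        _ ≤ 2 * V + T * (2 / h * V) := by gcongr
        _ = _ := by ring
    rw [hB, div_mul_eq_mul_div, le_div_iff₀ (by positivity)]
    have h5 : d ^ 2 * ∑ k ∈ s.erase j, ‖f k‖ ^ 2 ≤ ∑ k ∈ s.erase j, ‖g k‖ ^ 2 := by
      rw [Finset.mul_sum]; exact Finset.sum_le_sum h3
    have h6 := mul_le_mul_of_nonneg_left h5 hc.le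
    linarith
  set D := B + (2 + 2 * C * B) / (T + h) with hD
  have hD0 : 0 < D := by positivity
  refine ⟨min c₁ D⁻¹, by positivity, fun s f hs => ?_⟩
  by_cases hj : j ∈ s
  · set V := ∫ t in (0 : ℝ)..(T + h), ‖freqSum s f t‖ ^ 2 with hV
    have h1 := hothers s f hs
    have h2 : (T + h) * ‖f j‖ ^ 2 ≤ (2 + 2 * C * B) * V := by
      have h3 : ∫ t in (0 : ℝ)..(T + h), ‖f j‖ ^ 2 ≤ ∫ t in (0 : ℝ)..(T + h),
          (2 * ‖freqSum s f t‖ ^ 2 + 2 * ‖freqSum (s.erase j) f t‖ ^ 2) := by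
        apply intervalIntegral.integral_mono_on (by linarith)
        · exact Continuous.intervalIntegrable (by fun_prop) _ _
        · exact Continuous.intervalIntegrable (by fun_prop) _ _
        · intro t _
          have h4 : timePhase (torusFreq j) t • f j = freqSum s f t - freqSum (s.erase j) f t := by
            unfold freqSum
            rw [← Finset.add_sum_erase s _ hj]; abel
          have h5 : ‖f j‖ = ‖freqSum s f t - freqSum (s.erase j) f t‖ := by
            rw [← h4, norm_smul, norm_timePhase, one_mul]
          rw [h5]
          have := pow_le_pow_left₀ (norm_nonneg _) (norm_sub_le (freqSum s f t) (freqSum (s.erase j) f t)) 2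
          nlinarith [sq_nonneg (‖freqSum s f t‖ - ‖freqSum (s.erase j) f t‖)]
      rw [intervalIntegral.integral_add (Continuous.intervalIntegrable (by fun_prop) _ _)
        (Continuous.intervalIntegrable (by fun_prop) _ _), intervalIntegral.integral_const_mul,
        intervalIntegral.integral_const_mul, intervalIntegral.integral_const, smul_eq_mul, sub_zero] at h3
      have h4 := (hup (s.erase j) f).trans (mul_le_mul_of_nonneg_left h1 hC.le)
      linarith
    have h3 : ∑ k ∈ s, ‖f k‖ ^ 2 ≤ D * V := by
      rw [← Finset.add_sum_erase s _ hj]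
      have : ‖f j‖ ^ 2 ≤ (2 + 2 * C * B) / (T + h) * V := by
        rw [div_mul_eq_mul_div, le_div_iff₀ (by linarith)]; linarith
      rw [hD]; linarith
    calc min c₁ D⁻¹ * ∑ k ∈ s, ‖f k‖ ^ 2 ≤ D⁻¹ * ∑ k ∈ s, ‖f k‖ ^ 2 := by
          gcongr; exact min_le_right _ _
      _ ≤ V := by rw [inv_mul_le_iff₀ hD0]; exact h3
  · have h1 : ∀ k ∈ s, j + 1 ≤ k := fun k hk => by
      have := hs k hk
      have : k ≠ j := fun h => hj (h ▸ hk)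
      omega
    refine le_trans ?_ (hI' s f h1)
    gcongr
    exact min_le_left _ _

theorem inghamBound_zero [CompleteSpace H] {T : ℝ} (hT : 0 < T) : InghamBound H 0 T := by
  obtain ⟨M, hM⟩ := exists_inghamBound (H := H) (T := T / 2) (by linarith)
  -- Quantifying over all T' > T/2 lets each step spend half of the excess T' - T/2.
  have key : ∀ n : ℕ, n ≤ M → ∀ T' > T / 2, InghamBound H (M - n) T' := by
    intro n
    induction n with
    | zero => intro _ T' hT'; exact hM T' hT'.le
    | succ n ih =>
      intro hn T' hT'
      have h1 := ih (by omega) (T / 2 + (T' - T / 2) / 2) (by linarith)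
      have h2 : M - n = (M - (n + 1)) + 1 := by omega
      rw [h2] at h1
      have h3 := h1.of_succ (h := (T' - T / 2) / 2) (by linarith) (by linarith)
      convert h3 using 1
      ring
  simpa using key M le_rfl T (by linarith)

end Ingham

/-! ### The free Schrödinger group -/

/-- The exponential `x ↦ exp(2πinx)` as an element of `L²(𝕋)`. -/
noncomputable def torusExp (n : ℤ) : L2Torus := fourierLp (T := (1 : ℝ)) 2 n

theorem orthonormal_torusExp : Orthonormal ℂ torusExp := orthonormal_fourier

theorem coe_fourierBasis_eq_torusExp :
    ⇑(fourierBasis (T := (1 : ℝ))) = torusExp := coe_fourierBasis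

theorem L2Torus.ext_inner {u v : L2Torus}
    (h : ∀ n, inner ℂ (torusExp n) u = inner ℂ (torusExp n) v) : u = v := by
  apply (fourierBasis (T := (1 : ℝ))).repr.injective
  ext n
  rw [HilbertBasis.repr_apply_apply, HilbertBasis.repr_apply_apply, coe_fourierBasis_eq_torusExp]
  exact h n

theorem L2Torus.hasSum_torusExp (u : L2Torus) :
    HasSum (fun n => inner ℂ (torusExp n) u • torusExp n) u := by
  have := (fourierBasis (T := (1 : ℝ))).hasSum_repr u
  simpa only [HilbertBasis.repr_apply_apply, coe_fourierBasis_eq_torusExp] using this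

/-- With the density of the span, this gives a second Hilbert basis, so the propagator can be
defined as the unitary carrying one basis to the other. -/
theorem orthonormal_phase_smul_torusExp (t : ℝ) :
    Orthonormal ℂ fun n => timePhase (torusFreq n) t • torusExp n := by
  rw [orthonormal_iff_ite]
  intro i j
  rw [inner_smul_left, inner_smul_right, orthonormal_iff_ite.mp orthonormal_torusExp i j]
  split_ifs with h
  · subst h
    rw [mul_one, conj_timePhase_mul_self]
  · simp

theorem span_phase_smul_torusExp (t : ℝ) :
    ⊤ ≤ (Submodule.span ℂ
      (range fun n => timePhase (torusFreq n) t • torusExp n)).topologicalClosure := by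
  have h1 : (Submodule.span ℂ (range torusExp)).topologicalClosure = ⊤ :=
    span_fourierLp_closure_eq_top (by simp)
  rw [← h1]
  apply Submodule.topologicalClosure_mono
  rw [Submodule.span_le]
  rintro _ ⟨n, rfl⟩
  have h2 : torusExp n = (timePhase (torusFreq n) t)⁻¹ • timePhase (torusFreq n) t • torusExp n := by
    rw [smul_smul, inv_mul_cancel₀ (timePhase_ne_zero _ _), one_smul]
  rw [h2]
  exact Submodule.smul_mem _ _ (Submodule.subset_span ⟨n, rfl⟩)

/-- The propagator `exp(it∂ₓ²)` of the free Schrödinger equation on `𝕋`. -/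
noncomputable def freeProp (t : ℝ) : L2Torus ≃ₗᵢ[ℂ] L2Torus :=
  (fourierBasis (T := (1 : ℝ))).repr.trans
    (HilbertBasis.mk (orthonormal_phase_smul_torusExp t) (span_phase_smul_torusExp t)).repr.symm

theorem freeProp_torusExp (t : ℝ) (n : ℤ) :
    freeProp t (torusExp n) = timePhase (torusFreq n) t • torusExp n := by
  classical
  have h1 : (fourierBasis (T := (1 : ℝ))).repr (torusExp n) = lp.single 2 n (1 : ℂ) := by
    rw [← coe_fourierBasis_eq_torusExp, HilbertBasis.repr_self]
  rw [freeProp, LinearIsometryEquiv.trans_apply, h1, HilbertBasis.repr_symm_single,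
    HilbertBasis.coe_mk]

theorem inner_torusExp_freeProp (t : ℝ) (n : ℤ) (u : L2Torus) :
    inner ℂ (torusExp n) (freeProp t u) = timePhase (torusFreq n) t * inner ℂ (torusExp n) u := by
  have h1 := (freeProp t).inner_map_map (torusExp n) u
  rw [freeProp_torusExp, inner_smul_left] at h1
  rw [← h1, ← mul_assoc, mul_comm (timePhase _ _), conj_timePhase_mul_self, one_mul]

@[simp] theorem freeProp_zero (u : L2Torus) : freeProp 0 u = u :=
  L2Torus.ext_inner fun n => by rw [inner_torusExp_freeProp, timePhase_zero, one_mul]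

theorem freeProp_add (s t : ℝ) (u : L2Torus) : freeProp (s + t) u = freeProp s (freeProp t u) :=
  L2Torus.ext_inner fun n => by
    rw [inner_torusExp_freeProp, inner_torusExp_freeProp, inner_torusExp_freeProp, timePhase_add,
      mul_assoc]

@[simp] theorem freeProp_neg_freeProp (t : ℝ) (u : L2Torus) : freeProp (-t) (freeProp t u) = u := by
  rw [← freeProp_add, neg_add_cancel, freeProp_zero]

@[simp] theorem freeProp_freeProp_neg (t : ℝ) (u : L2Torus) : freeProp t (freeProp (-t) u) = u := by
  rw [← freeProp_add, add_neg_cancel, freeProp_zero]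

theorem inner_freeProp_left (t : ℝ) (u v : L2Torus) :
    inner ℂ (freeProp t u) v = inner ℂ u (freeProp (-t) v) := by
  rw [← (freeProp (-t)).inner_map_map, freeProp_neg_freeProp]

/-- On trigonometric polynomials continuity is explicit; as each propagator is an isometry,
approximation of u is uniform in t. -/
theorem continuous_freeProp (u : L2Torus) : Continuous fun t => freeProp t u := by
  have hdense : DenseRange fun s : (ℤ →₀ ℂ) => s.sum fun n a => a • torusExp n := by
    have h1 : (Submodule.span ℂ (range torusExp)).topologicalClosure = ⊤ :=
      span_fourierLp_closure_eq_top (by simp)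
    rw [← Submodule.dense_iff_topologicalClosure_eq_top] at h1
    refine h1.mono fun x hx => ?_
    rw [SetLike.mem_coe, Finsupp.mem_span_range_iff_exists_finsupp] at hx
    exact hx
  apply continuous_of_uniform_approx_of_continuous
  intro V hV
  obtain ⟨ε, hε, hεV⟩ := Metric.mem_uniformity_dist.mp hV
  obtain ⟨s, hs⟩ := hdense.exists_dist_lt u hε
  refine ⟨fun t => freeProp t (s.sum fun n a => a • torusExp n), ?_, fun t => hεV ?_⟩
  · simp only [Finsupp.sum, map_sum, map_smul, freeProp_torusExp]
    fun_prop
  · rwa [LinearIsometryEquiv.dist_map]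

theorem Continuous.freeProp {X : Type*} [TopologicalSpace X] {τ : X → ℝ} {g : X → L2Torus}
    (hτ : Continuous τ) (hg : Continuous g) : Continuous fun x => freeProp (τ x) (g x) := by
  rw [continuous_iff_continuousAt]
  intro x₀
  have h1 : Filter.Tendsto (fun x => ‖g x - g x₀‖ + ‖_root_.freeProp (τ x) (g x₀) -
      _root_.freeProp (τ x₀) (g x₀)‖) (nhds x₀) (nhds 0) := by
    have hc : Continuous fun x => ‖g x - g x₀‖ + ‖_root_.freeProp (τ x) (g x₀) -
      _root_.freeProp (τ x₀) (g x₀)‖ :=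
      (hg.sub continuous_const).norm.add
        (((continuous_freeProp (g x₀)).comp hτ).sub continuous_const).norm
    simpa using hc.tendsto x₀
  rw [ContinuousAt, tendsto_iff_norm_sub_tendsto_zero]
  refine squeeze_zero (fun _ => norm_nonneg _) (fun x => ?_) h1
  calc _ = ‖_root_.freeProp (τ x) (g x - g x₀) + (_root_.freeProp (τ x) (g x₀) -
      _root_.freeProp (τ x₀) (g x₀))‖ := by rw [map_sub]; abel_nf
    _ ≤ _ := (norm_add_le _ _).trans (by rw [LinearIsometryEquiv.norm_map])

/-! ### Restriction to an open subset of the torus -/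

theorem restrictTo_ae_eq (ω : Set UnitAddCircle) (hω : IsOpen ω) (u : L2Torus) :
    restrictTo ω hω u =ᵐ[AddCircle.haarAddCircle (T := (1 : ℝ))] ω.indicator u :=
  MemLp.coeFn_toLp _

theorem inner_restrictTo_left (ω : Set UnitAddCircle) (hω : IsOpen ω) (u v : L2Torus) :
    inner ℂ (restrictTo ω hω u) v = inner ℂ u (restrictTo ω hω v) := by
  rw [L2.inner_def, L2.inner_def]
  refine integral_congr_ae ?_
  filter_upwards [restrictTo_ae_eq ω hω u, restrictTo_ae_eq ω hω v] with x hu hv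
  rw [hu, hv]
  by_cases hx : x ∈ ω <;> simp [hx]

theorem restrictTo_restrictTo (ω : Set UnitAddCircle) (hω : IsOpen ω) (u : L2Torus) :
    restrictTo ω hω (restrictTo ω hω u) = restrictTo ω hω u := by
  apply Lp.ext
  filter_upwards [restrictTo_ae_eq ω hω u, restrictTo_ae_eq ω hω (restrictTo ω hω u)] with x h1 h2
  rw [h2]
  by_cases hx : x ∈ ω
  · rw [indicator_of_mem hx]
  · rw [indicator_of_notMem hx, h1, indicator_of_notMem hx]

/-- Multiplication by 1_ω is symmetric and idempotent, hence an orthogonal projection. -/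
theorem inner_restrictTo_self (ω : Set UnitAddCircle) (hω : IsOpen ω) (u : L2Torus) :
    inner ℂ (restrictTo ω hω u) u = (‖restrictTo ω hω u‖ ^ 2 : ℂ) := by
  rw [← restrictTo_restrictTo, inner_restrictTo_left, inner_self_eq_norm_sq_to_K]
  simp [restrictTo_restrictTo]

/-- Restriction to an open set, as a bounded operator on `L²(𝕋)`. -/
noncomputable def restrictToL (ω : Set UnitAddCircle) (hω : IsOpen ω) : L2Torus →L[ℂ] L2Torus :=
  LinearMap.mkContinuous
    { toFun := restrictTo ω hω
      map_add' := fun u v => by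
        apply Lp.ext
        filter_upwards [restrictTo_ae_eq ω hω (u + v), restrictTo_ae_eq ω hω u,
          restrictTo_ae_eq ω hω v, Lp.coeFn_add u v,
          Lp.coeFn_add (restrictTo ω hω u) (restrictTo ω hω v)] with x h1 h2 h3 h4 h5
        rw [h1, h5, Pi.add_apply, h2, h3]
        by_cases hx : x ∈ ω
        · simp only [indicator_of_mem hx]
          exact h4
        · simp [hx]
      map_smul' := fun c u => by
        apply Lp.ext
        filter_upwards [restrictTo_ae_eq ω hω (c • u), restrictTo_ae_eq ω hω u, Lp.coeFn_smul c u,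
          Lp.coeFn_smul c (restrictTo ω hω u)] with x h1 h2 h3 h4
        rw [h1, RingHom.id_apply, h4, Pi.smul_apply, h2]
        by_cases hx : x ∈ ω
        · simp only [indicator_of_mem hx]
          exact h3
        · simp [hx] }
    1 fun u => by
      rw [one_mul]
      have h1 : ‖restrictTo ω hω u‖ ^ 2 ≤ ‖restrictTo ω hω u‖ * ‖u‖ := by
        have := norm_inner_le_norm (𝕜 := ℂ) (restrictTo ω hω u) u
        rw [inner_restrictTo_self] at this
        simpa using this
      by_contra hlt
      rw [not_le] at hlt
      have h2 : ‖u‖ < ‖restrictTo ω hω u‖ := hlt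
      nlinarith [norm_nonneg u]

@[simp] theorem restrictToL_apply (ω : Set UnitAddCircle) (hω : IsOpen ω) (u : L2Torus) :
    restrictToL ω hω u = restrictTo ω hω u := rfl

theorem norm_restrictTo_le (ω : Set UnitAddCircle) (hω : IsOpen ω) (u : L2Torus) :
    ‖restrictTo ω hω u‖ ≤ ‖u‖ := by
  simpa using (restrictToL ω hω).le_of_opNorm_le (LinearMap.mkContinuous_norm_le _ zero_le_one _) u

theorem continuous_restrictTo (ω : Set UnitAddCircle) (hω : IsOpen ω) :
    Continuous (restrictTo ω hω) := (restrictToL ω hω).continuous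

/-! ### Lower bounds for eigenfunctions on an open set -/

theorem exists_Icc_subset_of_isOpen {ω : Set UnitAddCircle} (hω : IsOpen ω) (hne : ω.Nonempty) :
    ∃ a l : ℝ, 0 < l ∧ l ≤ 1 ∧ ∀ x ∈ Icc a (a + l), (x : UnitAddCircle) ∈ ω := by
  obtain ⟨y, hy⟩ := hne
  obtain ⟨x, rfl⟩ := QuotientAddGroup.mk_surjective y
  have h1 : IsOpen ((fun x : ℝ => (x : UnitAddCircle)) ⁻¹' ω) :=
    hω.preimage (AddCircle.continuous_mk' 1)
  obtain ⟨ε, hε, hball⟩ := Metric.isOpen_iff.mp h1 x hy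
  -- Capping the length at 1 keeps the interval within a single period starting at its left end.
  refine ⟨x, min 1 (ε / 2), by positivity, min_le_left _ _, fun z hz => hball ?_⟩
  rw [Metric.mem_ball, Real.dist_eq, abs_of_nonneg (by linarith [hz.1])]
  linarith [hz.2, min_le_right 1 (ε / 2)]

theorem integral_haarAddCircle_eq (a : ℝ) {E : Type*} [NormedAddCommGroup E] [NormedSpace ℝ E]
    (F : UnitAddCircle → E) :
    ∫ x, F x ∂(AddCircle.haarAddCircle (T := (1 : ℝ))) = ∫ x in a..(a + 1), F (x : UnitAddCircle) := by
  rw [UnitAddCircle.intervalIntegral_preimage, AddCircle.volume_eq_smul_haarAddCircle,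
    ENNReal.ofReal_one, one_smul]

theorem L2Torus.norm_sq_eq_integral (u : L2Torus) :
    ‖u‖ ^ 2 = ∫ x, ‖u x‖ ^ 2 ∂(AddCircle.haarAddCircle (T := (1 : ℝ))) := by
  have h1 : ((‖u‖ ^ 2 : ℝ) : ℂ) = inner ℂ u u := by
    rw [inner_self_eq_norm_sq_to_K]; push_cast; rfl
  rw [L2.inner_def] at h1
  have h2 : ∀ x, inner ℂ (u x) (u x) = ((‖u x‖ ^ 2 : ℝ) : ℂ) := fun x => by
    rw [inner_self_eq_norm_sq_to_K]; push_cast; rfl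
  simp_rw [h2] at h1
  rw [integral_complex_ofReal] at h1
  exact_mod_cast h1

theorem integral_norm_sq_le_norm_restrictTo_sq {ω : Set UnitAddCircle} (hω : IsOpen ω) {a l : ℝ}
    (hl : 0 ≤ l) (hl1 : l ≤ 1) (hal : ∀ x ∈ Icc a (a + l), (x : UnitAddCircle) ∈ ω)
    (F : C(UnitAddCircle, ℂ)) :
    ∫ x in a..(a + l), ‖F (x : UnitAddCircle)‖ ^ 2 ≤ ‖restrictTo ω hω
      (ContinuousMap.toLp 2 (AddCircle.haarAddCircle (T := (1 : ℝ))) ℂ F)‖ ^ 2 := by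
  have hFc : Continuous fun x : ℝ => ‖F (x : UnitAddCircle)‖ ^ 2 :=
    (((F.continuous.comp (AddCircle.continuous_mk' 1))).norm.pow 2)
  have h1 : ‖restrictTo ω hω (ContinuousMap.toLp 2 (AddCircle.haarAddCircle (T := (1 : ℝ))) ℂ F)‖ ^ 2 =
      ∫ x in a..(a + 1), ((fun x : ℝ => (x : UnitAddCircle)) ⁻¹' ω).indicator
        (fun x : ℝ => ‖F (x : UnitAddCircle)‖ ^ 2) x := by
    rw [L2Torus.norm_sq_eq_integral]
    have : ∀ x : ℝ, ((fun x : ℝ => (x : UnitAddCircle)) ⁻¹' ω).indicator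
        (fun x : ℝ => ‖F (x : UnitAddCircle)‖ ^ 2) x =
          (ω.indicator fun y => ‖F y‖ ^ 2) (x : UnitAddCircle) := fun x => by
      rw [← indicator_comp_right (fun x : ℝ => (x : UnitAddCircle))]; rfl
    simp_rw [this]
    rw [← integral_haarAddCircle_eq a (ω.indicator fun y => ‖F y‖ ^ 2)]
    refine integral_congr_ae ?_
    filter_upwards [restrictTo_ae_eq ω hω
      (ContinuousMap.toLp 2 (AddCircle.haarAddCircle (T := (1 : ℝ))) ℂ F),
      ContinuousMap.coeFn_toLp (p := 2) (𝕜 := ℂ) (AddCircle.haarAddCircle (T := (1 : ℝ))) F]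
      with x h1 h2
    rw [h1]
    by_cases hx : x ∈ ω
    · rw [indicator_of_mem hx, indicator_of_mem hx, h2]
    · rw [indicator_of_notMem hx, indicator_of_notMem hx]; simp
  have hmeas : MeasurableSet ((fun x : ℝ => (x : UnitAddCircle)) ⁻¹' ω) :=
    (hω.preimage (AddCircle.continuous_mk' 1)).measurableSet
  rw [h1]
  calc ∫ x in a..(a + l), ‖F (x : UnitAddCircle)‖ ^ 2
      = ∫ x in a..(a + l), ((fun x : ℝ => (x : UnitAddCircle)) ⁻¹' ω).indicator
        (fun x : ℝ => ‖F (x : UnitAddCircle)‖ ^ 2) x := by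
        refine intervalIntegral.integral_congr fun x hx => ?_
        rw [uIcc_of_le (by linarith)] at hx
        exact (indicator_of_mem (s := (fun x : ℝ => (x : UnitAddCircle)) ⁻¹' ω) (hal x hx)
          (fun x : ℝ => ‖F (x : UnitAddCircle)‖ ^ 2)).symm
    _ ≤ _ := by
        apply intervalIntegral.integral_mono_interval le_rfl (by linarith) (by linarith)
        · exact Filter.Eventually.of_forall fun x => indicator_nonneg (fun _ _ => by positivity) _
        · have h3 := hFc.intervalIntegrable (μ := volume) a (a + 1)
          rw [intervalIntegrable_iff] at h3 ⊢
          exact h3.indicator hmeas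

theorem fourier_coe_eq (n : ℤ) (x : ℝ) :
    fourier n (x : UnitAddCircle) = Complex.exp (Complex.I * ((2 * Real.pi * n * x : ℝ) : ℂ)) := by
  rw [fourier_coe_apply]; congr 1; push_cast; ring

/-- The cross term is an integral of exp(4πikx), of modulus at most (1 - d)l uniformly in k ≥ 1
because 4πk ≥ 1; AM-GM absorbs it into the diagonal. -/
theorem integral_norm_two_modes_sq_ge {l : ℝ} (hl : 0 < l) :
    ∃ d : ℝ, 0 < d ∧ ∀ (k : ℕ), k ≠ 0 → ∀ (a : ℝ) (c₁ c₂ : ℂ),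
      d * (‖c₁‖ ^ 2 + ‖c₂‖ ^ 2) ≤ ∫ x in a..(a + l),
        ‖c₁ * fourier (k : ℤ) (x : UnitAddCircle) + c₂ * fourier (-k : ℤ) (x : UnitAddCircle)‖ ^ 2 := by
  obtain ⟨d, hd, h⟩ := norm_integral_exp_le hl one_pos
  refine ⟨d * l, by positivity, fun k hk a c₁ c₂ => ?_⟩
  set β : ℝ := 4 * Real.pi * k with hβ
  have hβ1 : 1 ≤ |β| := by
    have : (1 : ℝ) ≤ k := by exact_mod_cast Nat.one_le_iff_ne_zero.mpr hk
    rw [abs_of_nonneg (by positivity)]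
    nlinarith [Real.pi_gt_three]
  set J := ∫ x in a..(a + l), Complex.exp (Complex.I * β * x) with hJ
  have hJle : ‖J‖ ≤ (1 - d) * l := h β hβ1 a
  have hpt : ∀ x : ℝ,
      ‖c₁ * fourier (k : ℤ) (x : UnitAddCircle) + c₂ * fourier (-k : ℤ) (x : UnitAddCircle)‖ ^ 2 =
        (‖c₁‖ ^ 2 + ‖c₂‖ ^ 2) +
          Complex.reCLM (2 * (c₁ * starRingEnd ℂ c₂) * Complex.exp (Complex.I * β * x)) := by
    intro x
    rw [Complex.sq_norm, Complex.normSq_add, ← Complex.sq_norm, ← Complex.sq_norm, norm_mul, norm_mul,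
      fourier_coe_eq, fourier_coe_eq, Complex.norm_exp_I_mul_ofReal, Complex.norm_exp_I_mul_ofReal,
      mul_one, mul_one, map_mul, ← Complex.exp_conj]
    have h2 : c₁ * Complex.exp (Complex.I * ((2 * Real.pi * (k : ℤ) * x : ℝ) : ℂ)) *
        (starRingEnd ℂ c₂ * Complex.exp (starRingEnd ℂ
          (Complex.I * ((2 * Real.pi * (-k : ℤ) * x : ℝ) : ℂ)))) =
        c₁ * starRingEnd ℂ c₂ * Complex.exp (Complex.I * β * x) := by
      rw [mul_mul_mul_comm, ← Complex.exp_add]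
      congr 2
      rw [map_mul, Complex.conj_I, Complex.conj_ofReal, hβ]
      push_cast
      ring
    rw [h2, Complex.reCLM_apply, mul_assoc 2, Complex.mul_re 2]
    simp
  simp_rw [hpt]
  rw [intervalIntegral.integral_add (Continuous.intervalIntegrable (by fun_prop) _ _)
    (Continuous.intervalIntegrable (by fun_prop) _ _), intervalIntegral.integral_const,
    ContinuousLinearMap.intervalIntegral_comp_comm _ (Continuous.intervalIntegrable (by fun_prop) _ _),
    intervalIntegral.integral_const_mul, ← hJ, Complex.reCLM_apply, smul_eq_mul, add_sub_cancel_left]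
  have h3 : |(2 * (c₁ * starRingEnd ℂ c₂) * J).re| ≤ 2 * (‖c₁‖ * ‖c₂‖) * ((1 - d) * l) := by
    refine (Complex.abs_re_le_norm _).trans ?_
    rw [norm_mul, norm_mul, norm_mul, RCLike.norm_conj, Complex.norm_ofNat]
    gcongr
  have h4 := (abs_le.mp h3).1
  have h5 : 0 ≤ (1 - d) * l := (norm_nonneg _).trans hJle
  nlinarith [mul_nonneg h5 (sq_nonneg (‖c₁‖ - ‖c₂‖))]

theorem norm_restrictTo_eigenfunction_sq_ge {ω : Set UnitAddCircle} (hω : IsOpen ω)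
    (hne : ω.Nonempty) :
    ∃ d : ℝ, 0 < d ∧ ∀ (k : ℕ) (q : Finset ℤ), (∀ n ∈ q, n.natAbs = k) → ∀ a : ℤ → ℂ,
      d * ∑ n ∈ q, ‖a n‖ ^ 2 ≤ ‖restrictTo ω hω (∑ n ∈ q, a n • torusExp n)‖ ^ 2 := by
  obtain ⟨x₀, l, hl, hl1, hsub⟩ := exists_Icc_subset_of_isOpen hω hne
  obtain ⟨d, hd, h⟩ := integral_norm_two_modes_sq_ge hl
  refine ⟨min d l, by positivity, fun k q hq a => ?_⟩
  set b : ℤ → ℂ := fun n => if n ∈ q then a n else 0 with hb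
  -- Coefficients are extended by zero to the full pair ±k, which collapses to a single constant
  -- mode when k = 0.
  set Q : Finset ℤ := {(k : ℤ), (-k : ℤ)} with hQ
  have hqQ : q ⊆ Q := fun n hn => by
    have := hq n hn
    simp only [hQ, Finset.mem_insert, Finset.mem_singleton]
    omega
  have h1 : ∑ n ∈ q, ‖a n‖ ^ 2 = ∑ n ∈ Q, ‖b n‖ ^ 2 := by
    rw [← Finset.sum_subset hqQ fun n _ hn => by simp [hb, hn]]
    exact Finset.sum_congr rfl fun n hn => by simp [hb, hn]
  have h2 : ∑ n ∈ q, a n • torusExp n = ∑ n ∈ Q, b n • torusExp n := by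
    rw [← Finset.sum_subset hqQ fun n _ hn => by simp [hb, hn]]
    exact Finset.sum_congr rfl fun n hn => by simp [hb, hn]
  have h3 : ∑ n ∈ Q, b n • torusExp n = ContinuousMap.toLp 2
      (AddCircle.haarAddCircle (T := (1 : ℝ))) ℂ (∑ n ∈ Q, b n • (fourier n : C(UnitAddCircle, ℂ))) := by
    rw [map_sum]
    exact Finset.sum_congr rfl fun n _ => by rw [map_smul]; rfl
  rw [h1, h2, h3]
  refine le_trans ?_ (integral_norm_sq_le_norm_restrictTo_sq hω hl.le hl1 hsub _)
  rcases eq_or_ne k 0 with rfl | hk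
  · have : Q = {0} := by rw [hQ]; rfl
    rw [this]
    simp only [Finset.sum_singleton]
    have h4 : ∀ x : ℝ, ‖(b 0 • (fourier 0 : C(UnitAddCircle, ℂ))) (x : UnitAddCircle)‖ ^ 2 = ‖b 0‖ ^ 2 := by
      intro x
      rw [ContinuousMap.smul_apply, fourier_zero, smul_eq_mul, mul_one]
    simp_rw [h4]
    rw [intervalIntegral.integral_const, smul_eq_mul, add_sub_cancel_left]
    gcongr
    exact min_le_right _ _
  · have hne : (k : ℤ) ≠ -k := by omega
    rw [hQ, Finset.sum_pair hne, Finset.sum_pair hne]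
    refine le_trans ?_ (h k hk x₀ (b k) (b (-k)))
    gcongr
    exact min_le_left _ _

/-! ### Observability and the HUM operator -/

theorem inner_intervalIntegral {F : ℝ → L2Torus} (hF : Continuous F) (w : L2Torus) (a b : ℝ) :
    inner ℂ w (∫ s in a..b, F s) = ∫ s in a..b, inner ℂ w (F s) :=
  ((innerSL ℂ w).intervalIntegral_comp_comm (hF.intervalIntegrable a b)).symm

theorem continuous_observed (ω : Set UnitAddCircle) (hω : IsOpen ω) (u : L2Torus) :
    Continuous fun s => restrictTo ω hω (freeProp s u) :=
  (continuous_restrictTo ω hω).comp (continuous_freeProp u)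

theorem continuous_humIntegrand (ω : Set UnitAddCircle) (hω : IsOpen ω) (u : L2Torus) :
    Continuous fun s => freeProp (-s) (restrictTo ω hω (freeProp s u)) :=
  continuous_neg.freeProp (continuous_observed ω hω u)

/-- The HUM operator `u ↦ ∫₀ᵀ exp(-is∂ₓ²) 1_ω exp(is∂ₓ²) u ds`. -/
noncomputable def humOp (ω : Set UnitAddCircle) (hω : IsOpen ω) (T : ℝ) : L2Torus →L[ℂ] L2Torus :=
  LinearMap.mkContinuous
    { toFun := fun u => ∫ s in (0 : ℝ)..T, freeProp (-s) (restrictTo ω hω (freeProp s u))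
      map_add' := fun u v => by
        rw [← intervalIntegral.integral_add
          ((continuous_humIntegrand ω hω u).intervalIntegrable _ _)
          ((continuous_humIntegrand ω hω v).intervalIntegrable _ _)]
        simp only [← restrictToL_apply, map_add]
      map_smul' := fun c u => by
        rw [RingHom.id_apply, ← intervalIntegral.integral_smul]
        simp only [← restrictToL_apply, map_smul] }
    |T| fun u => by
      have := intervalIntegral.norm_integral_le_of_norm_le_const (a := 0) (b := T) (C := ‖u‖)
        (f := fun s => freeProp (-s) (restrictTo ω hω (freeProp s u))) fun s _ => by
          rw [LinearIsometryEquiv.norm_map]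
          exact (norm_restrictTo_le ω hω _).trans (LinearIsometryEquiv.norm_map _ _).le
      rw [sub_zero, mul_comm] at this
      exact this

theorem humOp_apply (ω : Set UnitAddCircle) (hω : IsOpen ω) (T : ℝ) (u : L2Torus) :
    humOp ω hω T u = ∫ s in (0 : ℝ)..T, freeProp (-s) (restrictTo ω hω (freeProp s u)) := rfl

theorem inner_humOp_right (ω : Set UnitAddCircle) (hω : IsOpen ω) (T : ℝ) (u v : L2Torus) :
    inner ℂ u (humOp ω hω T v) =
      ∫ s in (0 : ℝ)..T, inner ℂ (freeProp s u) (restrictTo ω hω (freeProp s v)) := by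
  rw [humOp_apply, inner_intervalIntegral (continuous_humIntegrand ω hω v)]
  simp_rw [inner_freeProp_left]

theorem isSymmetric_humOp (ω : Set UnitAddCircle) (hω : IsOpen ω) (T : ℝ) (u v : L2Torus) :
    inner ℂ (humOp ω hω T u) v = inner ℂ u (humOp ω hω T v) := by
  rw [← inner_conj_symm, inner_humOp_right, inner_humOp_right]
  have h1 : starRingEnd ℂ (∫ s in (0 : ℝ)..T, inner ℂ (freeProp s v) (restrictTo ω hω (freeProp s u))) =
      ∫ s in (0 : ℝ)..T, starRingEnd ℂ (inner ℂ (freeProp s v) (restrictTo ω hω (freeProp s u))) :=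
    (Complex.conjCLE.toContinuousLinearMap.intervalIntegral_comp_comm
      (Continuous.intervalIntegrable
        ((continuous_freeProp v).inner (continuous_observed ω hω u)) _ _)).symm
  rw [h1]
  simp_rw [inner_conj_symm, inner_restrictTo_left]

theorem inner_humOp_self (ω : Set UnitAddCircle) (hω : IsOpen ω) (T : ℝ) (u : L2Torus) :
    inner ℂ (humOp ω hω T u) u =
      ((∫ s in (0 : ℝ)..T, ‖restrictTo ω hω (freeProp s u)‖ ^ 2 : ℝ) : ℂ) := by
  rw [isSymmetric_humOp, inner_humOp_right, ← intervalIntegral.integral_ofReal]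
  refine intervalIntegral.integral_congr fun s _ => ?_
  rw [← inner_restrictTo_left, inner_restrictTo_self]
  push_cast
  rfl

theorem norm_sum_smul_torusExp_sq (s : Finset ℤ) (a : ℤ → ℂ) :
    ‖∑ n ∈ s, a n • torusExp n‖ ^ 2 = ∑ n ∈ s, ‖a n‖ ^ 2 := by
  have h := orthonormal_torusExp.inner_sum a a s
  rw [inner_self_eq_norm_sq_to_K] at h
  simp_rw [RCLike.conj_mul] at h
  exact_mod_cast h

/-- Observability of the free Schrödinger equation from a nonempty open set. -/
theorem exists_observability {ω : Set UnitAddCircle} (hω : IsOpen ω) (hne : ω.Nonempty) {T : ℝ}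
    (hT : 0 < T) :
    ∃ c : ℝ, 0 < c ∧ ∀ u : L2Torus,
      c * ‖u‖ ^ 2 ≤ ∫ s in (0 : ℝ)..T, ‖restrictTo ω hω (freeProp s u)‖ ^ 2 := by
  obtain ⟨c, hc, hI⟩ := inghamBound_zero (H := L2Torus) hT
  obtain ⟨d, hd, hE⟩ := norm_restrictTo_eigenfunction_sq_ge hω hne
  refine ⟨c * d, by positivity, fun u => ?_⟩
  have hpoly : ∀ (s : Finset ℤ) (a : ℤ → ℂ), c * d * ‖∑ n ∈ s, a n • torusExp n‖ ^ 2 ≤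
      ∫ t in (0 : ℝ)..T, ‖restrictTo ω hω (freeProp t (∑ n ∈ s, a n • torusExp n))‖ ^ 2 := by
    intro s a
    -- Modes n and -n have the same frequency and cannot be separated in time; keeping them together
    -- in one L²-valued coefficient is why a vector-valued Ingham inequality is needed.
    set f : ℕ → L2Torus := fun k =>
      restrictTo ω hω (∑ n ∈ s with n.natAbs = k, a n • torusExp n) with hf
    have h1 : ∀ t, restrictTo ω hω (freeProp t (∑ n ∈ s, a n • torusExp n)) =
        freqSum (s.image Int.natAbs) f t := by
      intro t
      unfold freqSum
      simp only [hf, ← restrictToL_apply, ← map_smul]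
      rw [← map_sum]
      congr 1
      rw [map_sum, ← Finset.sum_fiberwise_of_maps_to (t := s.image Int.natAbs) (g := Int.natAbs)
        fun n hn => Finset.mem_image_of_mem _ hn]
      refine Finset.sum_congr rfl fun k _ => ?_
      rw [Finset.smul_sum]
      refine Finset.sum_congr rfl fun n hn => ?_
      have h2 : torusFreq n = torusFreq k := by
        rw [← (Finset.mem_filter.mp hn).2]
        unfold torusFreq
        rw [mul_pow, mul_pow (2 * Real.pi)]
        congr 1
        have := Int.natAbs_sq n
        exact_mod_cast this.symm
      rw [map_smul, freeProp_torusExp, smul_comm, h2]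
    simp_rw [h1]
    refine le_trans ?_ (hI _ f fun k _ => Nat.zero_le k)
    rw [mul_assoc]
    gcongr
    rw [norm_sum_smul_torusExp_sq,
      ← Finset.sum_fiberwise_of_maps_to (t := s.image Int.natAbs) (g := Int.natAbs)
        fun n hn => Finset.mem_image_of_mem _ hn, Finset.mul_sum]
    exact Finset.sum_le_sum fun k _ => hE k _ (fun n hn => (Finset.mem_filter.mp hn).2) a
  -- Written as a quadratic form of a bounded operator, the observed energy is continuous in u, so
  -- the bound passes from trigonometric polynomials to the limit.
  have hre : ∀ u : L2Torus, ∫ s in (0 : ℝ)..T, ‖restrictTo ω hω (freeProp s u)‖ ^ 2 =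
      (inner ℂ (humOp ω hω T u) u).re := fun u => by
    rw [inner_humOp_self, Complex.ofReal_re]
  simp_rw [hre] at hpoly ⊢
  have hlim : Filter.Tendsto (fun s : Finset ℤ => ∑ n ∈ s, inner ℂ (torusExp n) u • torusExp n)
    Filter.atTop (nhds u) := u.hasSum_torusExp
  refine le_of_tendsto_of_tendsto' ((hlim.norm.pow 2).const_mul (c * d)) ?_
    fun s => hpoly s fun n => inner ℂ (torusExp n) u
  exact Complex.continuous_re.continuousAt.tendsto.comp
    ((((humOp ω hω T).continuous.tendsto u).comp hlim).inner hlim)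

/-! ### Weak solutions of the Schrödinger equation -/

theorem torusPairing_eq_integral {φ : ℝ → ℂ} (hper : Function.Periodic φ 1) (u : L2Torus) :
    torusPairing u φ =
      ∫ y, u y * hper.lift y ∂(AddCircle.haarAddCircle (T := (1 : ℝ))) := by
  rw [integral_haarAddCircle_eq 0, zero_add]
  rfl

/-- The pairing is bilinear while the inner product conjugates its first argument, so the
representative is the conjugate of φ. -/
theorem exists_inner_eq_torusPairing {φ : ℝ → ℂ} (hφ : Continuous φ) (hper : Function.Periodic φ 1) :
    ∃ w : L2Torus, ∀ u, torusPairing u φ = inner ℂ w u := by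
  have hlift : Continuous hper.lift :=
    continuous_coinduced_dom.mpr hφ
  set F : C(UnitAddCircle, ℂ) := ⟨fun y => starRingEnd ℂ (hper.lift y), by fun_prop⟩ with hF
  refine ⟨ContinuousMap.toLp 2 (AddCircle.haarAddCircle (T := (1 : ℝ))) ℂ F, fun u => ?_⟩
  rw [torusPairing_eq_integral hper, L2.inner_def]
  refine integral_congr_ae ?_
  filter_upwards [ContinuousMap.coeFn_toLp (p := 2) (𝕜 := ℂ)
    (AddCircle.haarAddCircle (T := (1 : ℝ))) F] with y hy
  rw [hy, RCLike.inner_apply, hF]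
  simp

/-- The test function `x ↦ exp(-2πinx)`. -/
noncomputable def expTest (n : ℤ) (x : ℝ) : ℂ := Complex.exp (-(2 * Real.pi * n * Complex.I) * x)

theorem contDiff_expTest (n : ℤ) {k : WithTop ℕ∞} : ContDiff ℝ k (expTest n) := by
  unfold expTest
  exact (contDiff_const.mul Complex.ofRealCLM.contDiff).cexp

theorem periodic_expTest (n : ℤ) : Function.Periodic (expTest n) 1 := by
  intro x
  unfold expTest
  have h : -(2 * Real.pi * n * Complex.I) * ((x + 1 : ℝ) : ℂ) =
      -(2 * Real.pi * n * Complex.I) * x + ((-n : ℤ) : ℂ) * (2 * Real.pi * Complex.I) := by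
    push_cast; ring
  rw [h, Complex.exp_add, Complex.exp_int_mul_two_pi_mul_I, mul_one]

theorem hasDerivAt_expTest (n : ℤ) (x : ℝ) :
    HasDerivAt (expTest n) (-(2 * Real.pi * n * Complex.I) * expTest n x) x := by
  have h0 : HasDerivAt (fun t : ℝ => (t : ℂ)) 1 x := Complex.ofRealCLM.hasDerivAt
  refine (h0.const_mul (-(2 * Real.pi * n * Complex.I))).cexp.congr_deriv ?_
  unfold expTest
  ring

theorem iteratedDeriv_two_expTest (n : ℤ) :
    iteratedDeriv 2 (expTest n) = fun x => -(torusFreq n : ℂ) * expTest n x := by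
  have h1 : ∀ c : ℂ, deriv (fun x : ℝ => c * expTest n x) =
      fun x => (c * -(2 * Real.pi * n * Complex.I)) * expTest n x := by
    intro c
    ext x
    refine ((hasDerivAt_expTest n x).const_mul c).deriv.trans ?_
    ring
  have h2 := h1 1
  simp only [one_mul] at h2
  rw [iteratedDeriv_succ, iteratedDeriv_one]
  rw [show deriv (expTest n) = _ from h2, h1]
  ext x
  congr 1
  unfold torusFreq
  push_cast
  linear_combination (2 * (Real.pi : ℂ) * n) ^ 2 * Complex.I_sq

theorem torusPairing_torusExp (n : ℤ) {φ : ℝ → ℂ} (hper : Function.Periodic φ 1) :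
    torusPairing (torusExp n) φ = ∫ x in (0 : ℝ)..1, expTest (-n) x * φ x := by
  have h1 : torusPairing (torusExp n) φ =
      ∫ y, fourier n y * hper.lift y ∂(AddCircle.haarAddCircle (T := (1 : ℝ))) := by
    rw [torusPairing_eq_integral hper]
    refine integral_congr_ae ?_
    filter_upwards [coeFn_fourierLp (T := (1 : ℝ)) 2 n] with y hy
    rw [← hy]; rfl
  rw [h1, integral_haarAddCircle_eq 0, zero_add]
  refine intervalIntegral.integral_congr fun x _ => ?_
  simp only [Function.Periodic.lift_coe]
  rw [fourier_coe_eq]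
  congr 1
  unfold expTest
  congr 1
  push_cast
  ring

theorem torusPairing_expTest (n : ℤ) (u : L2Torus) :
    torusPairing u (expTest n) = inner ℂ (torusExp n) u := by
  rw [← coe_fourierBasis_eq_torusExp, ← HilbertBasis.repr_apply_apply, fourierBasis_repr,
    fourierCoeff_eq_intervalIntegral _ _ 0]
  simp only [zero_add, one_div, inv_one, one_smul]
  unfold torusPairing
  refine intervalIntegral.integral_congr fun x _ => ?_
  simp only [smul_eq_mul]
  rw [mul_comm, fourier_coe_eq]
  congr 1
  unfold expTest
  congr 1
  push_cast
  ring

theorem torusPairing_const_mul (c : ℂ) (u : L2Torus) (φ : ℝ → ℂ) :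
    torusPairing u (fun x => c * φ x) = c * torusPairing u φ := by
  unfold torusPairing
  rw [← intervalIntegral.integral_const_mul]
  exact intervalIntegral.integral_congr fun x _ => by simp only; ring

/-- A continuous function with `y' = -iλy` in integrated form is determined by its initial value. -/
theorem eqOn_zero_of_integral_equation {T ξ : ℝ} {y : ℝ → ℂ} (hy : ContinuousOn y (Icc 0 T))
    (heq : ∀ t ∈ Icc 0 T, Complex.I * y t = ξ * ∫ s in (0 : ℝ)..t, y s) : EqOn y 0 (Icc 0 T) := by
  intro t ht
  have hT : 0 ≤ T := ht.1.trans ht.2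
  -- The continuous extension makes the primitive differentiable on both sides, even at 0 and T.
  set z : ℝ → ℂ := IccExtend hT (fun x => y x) with hz
  have hzc : Continuous z := by
    rw [hz]
    exact (continuousOn_iff_continuous_domRestrict.mp hy).Icc_extend'
  have hzy : ∀ s ∈ Icc 0 T, z s = y s := fun s hs => by
    rw [hz, IccExtend_of_mem hT _ hs]
  have hzy' : ∀ t ∈ Icc 0 T, ∫ s in (0 : ℝ)..t, y s = ∫ s in (0 : ℝ)..t, z s := by
    intro t ht
    refine intervalIntegral.integral_congr fun s hs => ?_
    rw [uIcc_of_le ht.1] at hs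
    exact (hzy s ⟨hs.1, hs.2.trans ht.2⟩).symm
  set Z : ℝ → ℂ := fun t => ∫ s in (0 : ℝ)..t, z s with hZ
  have hZd : ∀ t, HasDerivAt Z (z t) t := fun t => hzc.integral_hasStrictDerivAt 0 t |>.hasDerivAt
  have hrel : ∀ t ∈ Icc 0 T, z t = -(Complex.I * ξ) * Z t := by
    intro t ht
    have := heq t ht
    rw [hzy' t ht] at this
    rw [hzy t ht]
    linear_combination (-Complex.I) * this + y t * Complex.I_sq
  -- Integrating factor: the primitive satisfies Z' = -iξZ, so W is constant, and it starts at 0.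
  set W : ℝ → ℂ := fun t => Complex.exp (Complex.I * ξ * t) * Z t with hW
  have hWd : ∀ t ∈ Icc 0 T, HasDerivAt W 0 t := by
    intro t ht
    have h0 : HasDerivAt (fun t : ℝ => (t : ℂ)) 1 t := Complex.ofRealCLM.hasDerivAt
    refine ((h0.const_mul (Complex.I * ξ)).cexp.mul (hZd t)).congr_deriv ?_
    rw [hrel t ht]
    ring
  have hW0 : W t = W 0 := by
    have := intervalIntegral.integral_eq_sub_of_hasDerivAt (a := 0) (b := t) (f := W) (f' := fun _ => 0)
      (fun s hs => by
        rw [uIcc_of_le ht.1] at hs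
        exact hWd s ⟨hs.1, hs.2.trans ht.2⟩) (by simp)
    rw [intervalIntegral.integral_zero] at this
    exact (sub_eq_zero.mp this.symm)
  have hZt : Z t = 0 := by
    have : W 0 = 0 := by simp [hW, hZ]
    rw [this, hW] at hW0
    exact (mul_eq_zero.mp hW0).resolve_left (Complex.exp_ne_zero _)
  have := hrel t ht
  rw [hZt, mul_zero, hzy t ht] at this
  exact this

/-- Testing against exp(-2πinx) turns the difference of two solutions into a scalar equation for
each Fourier coefficient. Sources need only agree on [0, T], as the source of a dual pair is
determined only there. -/
theorem IsSchrodingerSolution.eqOn {T : ℝ} {g g' u v : ℝ → L2Torus}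
    (hu : IsSchrodingerSolution T g u) (hv : IsSchrodingerSolution T g' v)
    (hg : EqOn g g' (Icc 0 T)) (h0 : u 0 = v 0) : EqOn u v (Icc 0 T) := by
  intro t ht
  refine L2Torus.ext_inner fun n => ?_
  have key := eqOn_zero_of_integral_equation (T := T) (ξ := torusFreq n)
    (y := fun s => inner ℂ (torusExp n) (u s - v s))
    (continuousOn_const.inner (hu.continuousOn.sub hv.continuousOn)) ?_ ht
  · simpa [inner_sub_right, sub_eq_zero] using key
  intro t ht
  have h1 := hu.equation (expTest n) (contDiff_expTest n) (periodic_expTest n) t ht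
  have h2 := hv.equation (expTest n) (contDiff_expTest n) (periodic_expTest n) t ht
  have h3 : ∫ s in (0 : ℝ)..t, torusPairing (g s) (expTest n) =
      ∫ s in (0 : ℝ)..t, torusPairing (g' s) (expTest n) := by
    refine intervalIntegral.integral_congr fun s hs => ?_
    rw [uIcc_of_le ht.1] at hs
    rw [hg ⟨hs.1, hs.2.trans ht.2⟩]
  rw [iteratedDeriv_two_expTest] at h1 h2
  simp only [torusPairing_const_mul, torusPairing_expTest, intervalIntegral.integral_const_mul]
    at h1 h2 h3
  have hint : ∀ w : ℝ → L2Torus, ContinuousOn w (Icc 0 T) →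
      IntervalIntegrable (fun s => inner ℂ (torusExp n) (w s)) volume 0 t := by
    intro w hw
    apply ContinuousOn.intervalIntegrable
    rw [uIcc_of_le ht.1]
    exact continuousOn_const.inner (hw.mono (Icc_subset_Icc_right ht.2))
  simp only [inner_sub_right]
  rw [intervalIntegral.integral_sub (hint u hu.continuousOn) (hint v hv.continuousOn)]
  rw [h0] at h1
  linear_combination h1 - h2 + h3

/-- Two integrations by parts, whose boundary terms cancel by periodicity. In effect w₂ = ∂ₓ²w,
expressed through Fourier coefficients. -/
theorem inner_torusExp_eq_of_torusPairing {φ : ℝ → ℂ} (hφ : ContDiff ℝ 2 φ)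
    (hper : Function.Periodic φ 1) (hper₂ : Function.Periodic (iteratedDeriv 2 φ) 1)
    {w w₂ : L2Torus} (hw : ∀ u, torusPairing u φ = inner ℂ w u)
    (hw₂ : ∀ u, torusPairing u (iteratedDeriv 2 φ) = inner ℂ w₂ u) (n : ℤ) :
    inner ℂ (torusExp n) w₂ = -(torusFreq n : ℂ) * inner ℂ (torusExp n) w := by
  have hφ1 : ∀ x, HasDerivAt φ (deriv φ x) x := fun x =>
    (hφ.differentiable (by norm_num) x).hasDerivAt
  have hφ2 : ∀ x, HasDerivAt (deriv φ) (iteratedDeriv 2 φ x) x := fun x => by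
    have h := hφ.differentiable_iteratedDeriv 1 (by norm_num)
    rw [iteratedDeriv_one] at h
    rw [iteratedDeriv_succ, iteratedDeriv_one]
    exact (h x).hasDerivAt
  have hper1 : deriv φ 1 = deriv φ 0 := by
    have h1 : (fun x => φ (x + 1)) = φ := funext hper
    have h2 := deriv_comp_add_const φ 1 0
    rw [h1, zero_add] at h2
    exact h2.symm
  have hc2 : Continuous (iteratedDeriv 2 φ) := hφ.continuous_iteratedDeriv 2 le_rfl
  have hcφ := hφ.continuous
  have hcE : Continuous (expTest (-n)) := (contDiff_expTest (k := 0) (-n)).continuous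
  set c : ℂ := -(2 * Real.pi * (-n : ℤ) * Complex.I) with hc
  have hd : ∀ x ∈ uIcc (0 : ℝ) 1, HasDerivAt
      (fun x => expTest (-n) x * deriv φ x - c * (expTest (-n) x * φ x))
      (expTest (-n) x * iteratedDeriv 2 φ x - c ^ 2 * (expTest (-n) x * φ x)) x := by
    intro x _
    refine (((hasDerivAt_expTest (-n) x).mul (hφ2 x)).sub
      (((hasDerivAt_expTest (-n) x).mul (hφ1 x)).const_mul c)).congr_deriv ?_
    rw [← hc]
    ring
  have hint := intervalIntegral.integral_eq_sub_of_hasDerivAt hd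
    (Continuous.intervalIntegrable (by fun_prop) _ _)
  rw [intervalIntegral.integral_sub (Continuous.intervalIntegrable (by fun_prop) _ _)
    (Continuous.intervalIntegrable (by fun_prop) _ _), intervalIntegral.integral_const_mul,
    ← torusPairing_torusExp n hper, ← torusPairing_torusExp n hper₂, hw, hw₂, hper1,
    show φ 1 = φ 0 by simpa using hper 0,
    show expTest (-n) 1 = expTest (-n) 0 by simpa using periodic_expTest (-n) 0, sub_self] at hint
  have hc' : c ^ 2 = -(torusFreq n : ℂ) := by
    rw [hc]
    unfold torusFreq
    push_cast
    linear_combination (2 * (Real.pi : ℂ) * n) ^ 2 * Complex.I_sq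
  rw [hc'] at hint
  rw [← inner_conj_symm, ← inner_conj_symm (torusExp n) w, sub_eq_zero.mp hint, map_mul, map_neg,
    Complex.conj_ofReal]

theorem hasDerivAt_freeProp {w w₂ : L2Torus}
    (h : ∀ n, inner ℂ (torusExp n) w₂ = -(torusFreq n : ℂ) * inner ℂ (torusExp n) w) (t : ℝ) :
    HasDerivAt (fun t => freeProp t w) (Complex.I • freeProp t w₂) t := by
  have hc : Continuous fun s => Complex.I • freeProp s w₂ := by
    have := continuous_freeProp w₂
    fun_prop
  -- The integrated identity is checked on Fourier coefficients; the fundamental theorem of calculus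
  -- then differentiates it in L².
  have h1 : (fun t => freeProp t w) = fun t => w + ∫ s in (0 : ℝ)..t, Complex.I • freeProp s w₂ := by
    ext1 t
    refine L2Torus.ext_inner fun n => ?_
    rw [inner_torusExp_freeProp, inner_add_right, inner_intervalIntegral hc]
    simp_rw [inner_smul_right, inner_torusExp_freeProp, h]
    have hd : ∀ s ∈ uIcc 0 t, HasDerivAt
        (fun s => timePhase (torusFreq n) s * inner ℂ (torusExp n) w)
        (Complex.I * (timePhase (torusFreq n) s *
          (-(torusFreq n : ℂ) * inner ℂ (torusExp n) w))) s := by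
      intro s _
      have h0 : HasDerivAt (fun t : ℝ => (t : ℂ)) 1 s := Complex.ofRealCLM.hasDerivAt
      refine ((h0.const_mul (Complex.I * torusFreq n)).neg.cexp.mul_const _).congr_deriv ?_
      simp only [timePhase, Pi.neg_apply]
      ring
    rw [intervalIntegral.integral_eq_sub_of_hasDerivAt hd
      (Continuous.intervalIntegrable (by fun_prop) _ _), timePhase_zero]
    ring
  rw [h1]
  exact ((hc.integral_hasStrictDerivAt 0 t).hasDerivAt).const_add w

/-- Duhamel's formula. -/
noncomputable def duhamel (u₀ : L2Torus) (g : ℝ → L2Torus) (t : ℝ) : L2Torus :=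
  freeProp t (u₀ - Complex.I • ∫ s in (0 : ℝ)..t, freeProp (-s) (g s))

@[simp] theorem duhamel_zero (u₀ : L2Torus) (g : ℝ → L2Torus) : duhamel u₀ g 0 = u₀ := by
  simp [duhamel]

theorem isSchrodingerSolution_duhamel (T : ℝ) (u₀ : L2Torus) {g : ℝ → L2Torus} (hg : Continuous g) :
    IsSchrodingerSolution T g (duhamel u₀ g) := by
  have hgc : Continuous fun s => freeProp (-s) (g s) := continuous_neg.freeProp hg
  set z : ℝ → L2Torus := fun t => u₀ - Complex.I • ∫ s in (0 : ℝ)..t, freeProp (-s) (g s) with hz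
  have hzd : ∀ t, HasDerivAt z (-(Complex.I • freeProp (-t) (g t))) t := fun t =>
    ((hgc.integral_hasStrictDerivAt 0 t).hasDerivAt.const_smul Complex.I).const_sub u₀
  have hzc : Continuous z := continuous_iff_continuousAt.mpr fun t => (hzd t).continuousAt
  have huc : Continuous (duhamel u₀ g) := continuous_id.freeProp hzc
  refine ⟨hg.continuousOn.integrableOn_Icc, huc.continuousOn, fun φ hφ hper t ht => ?_⟩
  have hφ' : ContDiff ℝ 2 φ := hφ.of_le (WithTop.coe_le_coe.mpr le_top)
  have hφ₂ : Continuous (iteratedDeriv 2 φ) := hφ'.continuous_iteratedDeriv 2 le_rfl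
  have hper₂ : Function.Periodic (iteratedDeriv 2 φ) 1 := by
    intro x
    have h1 : (fun x => φ (x + 1)) = φ := funext hper
    have h2 := congrFun (iteratedDeriv_comp_add_const 2 φ 1) x
    rw [h1] at h2
    exact h2.symm
  obtain ⟨w, hw⟩ := exists_inner_eq_torusPairing hφ.continuous hper
  obtain ⟨w₂, hw₂⟩ := exists_inner_eq_torusPairing hφ₂ hper₂
  have hcoef := inner_torusExp_eq_of_torusPairing hφ' hper hper₂ hw hw₂
  simp_rw [hw, hw₂]
  have hyd : ∀ s ∈ uIcc 0 t, HasDerivAt (fun s => Complex.I * inner ℂ w (duhamel u₀ g s))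
      (inner ℂ w (g s) - inner ℂ w₂ (duhamel u₀ g s)) s := by
    intro s _
    -- The Duhamel solution need not be differentiable in L². Moving the group onto the smooth test
    -- function leaves a product of two differentiable factors.
    have h1 : ∀ s, inner ℂ w (duhamel u₀ g s) = inner ℂ (freeProp (-s) w) (z s) := fun s => by
      rw [inner_freeProp_left, neg_neg]; rfl
    have h2 : HasDerivAt (fun s => freeProp (-s) w) (-(Complex.I • freeProp (-s) w₂)) s := by
      have := (hasDerivAt_freeProp hcoef (-s)).scomp s (hasDerivAt_neg s)
      rw [neg_one_smul] at this
      exact this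
    simp_rw [h1]
    refine ((h2.inner ℂ (hzd s)).const_mul Complex.I).congr_deriv ?_
    rw [inner_neg_left, inner_neg_right, inner_smul_left, inner_smul_right,
      (freeProp (-s)).inner_map_map, inner_freeProp_left, neg_neg, Complex.conj_I]
    change Complex.I * (-(Complex.I * inner ℂ w (g s)) + -(-Complex.I * inner ℂ w₂ (duhamel u₀ g s))) = _
    linear_combination (inner ℂ w₂ (duhamel u₀ g s) - inner ℂ w (g s)) * Complex.I_sq
  have hwg : Continuous fun s => inner ℂ w (g s) := continuous_const.inner hg
  have hwu : Continuous fun s => inner ℂ w₂ (duhamel u₀ g s) := continuous_const.inner huc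
  have hint := intervalIntegral.integral_eq_sub_of_hasDerivAt hyd
    ((hwg.sub hwu).intervalIntegrable _ _)
  rw [intervalIntegral.integral_sub (hwg.intervalIntegrable _ _) (hwu.intervalIntegrable _ _)] at hint
  linear_combination -hint

/-! ### Exact controllability -/

theorem norm_sq_mul_le_norm_inner_humOp {ω : Set UnitAddCircle} (hω : IsOpen ω) {T c : ℝ} {u : L2Torus}
    (hobs : c * ‖u‖ ^ 2 ≤ ∫ s in (0 : ℝ)..T, ‖restrictTo ω hω (freeProp s u)‖ ^ 2) :
    ‖u‖ ^ 2 * c ≤ ‖inner ℂ (humOp ω hω T u) u‖ := by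
  rw [inner_humOp_self, Complex.norm_real, mul_comm]
  exact hobs.trans (le_abs_self _)

theorem exists_equiv_coe_eq_humOp {ω : Set UnitAddCircle} (hω : IsOpen ω) (hne : ω.Nonempty) {T : ℝ}
    (hT : 0 < T) :
    ∃ S : L2Torus ≃L[ℂ] L2Torus, (S : L2Torus →L[ℂ] L2Torus) = humOp ω hω T := by
  obtain ⟨c, hc, hobs⟩ := exists_observability hω hne hT
  have hu : IsUnit (humOp ω hω T) :=
    -- Coercivity implies invertibility, as in the Lax–Milgram theorem.
    ContinuousLinearMap.isUnit_of_forall_le_norm_inner_map _ (c := ⟨c, hc.le⟩) hc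
      fun u => norm_sq_mul_le_norm_inner_humOp hω (hobs u)
  exact ⟨ContinuousLinearEquiv.ofUnit hu.unit, by ext1 u; rfl⟩

theorem isSchrodingerSolution_freeProp (T : ℝ) (u₀ : L2Torus) :
    IsSchrodingerSolution T (fun _ => 0) fun t => freeProp t u₀ := by
  have h := isSchrodingerSolution_duhamel T u₀ (g := fun _ => 0) continuous_const
  have h1 : duhamel u₀ (fun _ => 0) = fun t => freeProp t u₀ := by
    ext1 t
    simp [duhamel]
  rwa [h1] at h

theorem duhamel_observed (ω : Set UnitAddCircle) (hω : IsOpen ω) (T : ℝ) (u₀ f : L2Torus) :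
    duhamel u₀ (fun s => restrictTo ω hω (freeProp s f)) T =
      freeProp T (u₀ - Complex.I • humOp ω hω T f) := rfl

/-- The datum Ψ(0) = iSf is exactly the one that cancels Duhamel's integral at time T. -/
theorem isDualControlPair_duhamel (ω : Set UnitAddCircle) (hω : IsOpen ω) (T : ℝ) (f : L2Torus) :
    IsDualControlPair ω hω T (fun t => freeProp t f)
      (duhamel (Complex.I • humOp ω hω T f) fun s => restrictTo ω hω (freeProp s f)) where
  free := isSchrodingerSolution_freeProp T f
  controlled := isSchrodingerSolution_duhamel T _ (continuous_observed ω hω f)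
  final := by rw [duhamel_observed, sub_self, map_zero]

/-- Uniqueness forces every dual pair to be the explicit one, so -iΨ(0) depends only on Φ(0). -/
theorem IsDualControlPair.humOp_eq {ω : Set UnitAddCircle} {hω : IsOpen ω} {T : ℝ} (hT : 0 ≤ T)
    {Φ Ψ : ℝ → L2Torus} (h : IsDualControlPair ω hω T Φ Ψ) :
    humOp ω hω T (Φ 0) = -(Complex.I • Ψ 0) := by
  have h1 : EqOn Φ (fun t => freeProp t (Φ 0)) (Icc 0 T) :=
    h.free.eqOn (isSchrodingerSolution_freeProp T (Φ 0)) (fun _ _ => rfl) (freeProp_zero _).symm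
  have h2 := h.controlled.eqOn
    (isSchrodingerSolution_duhamel T (Ψ 0) (continuous_observed ω hω (Φ 0)))
    (fun t ht => by simp only [h1 ht]) (duhamel_zero _ _).symm ⟨hT, le_rfl⟩
  rw [h.final, duhamel_observed, eq_comm, map_eq_zero_iff _ (freeProp T).injective, sub_eq_zero] at h2
  rw [h2, smul_smul, Complex.I_mul_I, neg_one_smul, neg_neg]

/-- Exact controllability in `L²(𝕋)` of the linear Schrödinger equation from any nonempty open set
in any positive time, and the HUM operator `S : Φ(0) ↦ -i Ψ(0)` is a positive self-adjoint
isomorphism of `L²(𝕋)`. -/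
theorem theorem3p2 (ω : Set UnitAddCircle) (hω : IsOpen ω) (hne : ω.Nonempty)
    (T : ℝ) (hT : 0 < T) :
    (∀ u₀ u₁ : L2Torus, ∃ g : ℝ → L2Torus,
      MemLp g ⊤ (volume.restrict (Icc 0 T)) ∧
      (∀ᵐ t ∂(volume.restrict (Icc 0 T)),
        ∀ᵐ x ∂(AddCircle.haarAddCircle (T := (1 : ℝ))), x ∉ ω → g t x = 0) ∧
      ∃ u : ℝ → L2Torus, IsSchrodingerSolution T g u ∧ u 0 = u₀ ∧ u T = u₁ ∧
        ∀ v : ℝ → L2Torus, IsSchrodingerSolution T g v → v 0 = u₀ → EqOn v u (Icc 0 T)) ∧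
    ∃ S : L2Torus ≃L[ℂ] L2Torus,
      (∀ Φ₀ : L2Torus, ∃ Φ Ψ : ℝ → L2Torus, IsDualControlPair ω hω T Φ Ψ ∧ Φ 0 = Φ₀) ∧
      (∀ Φ Ψ : ℝ → L2Torus, IsDualControlPair ω hω T Φ Ψ → S (Φ 0) = -(Complex.I • Ψ 0)) ∧
      IsSelfAdjoint (S : L2Torus →L[ℂ] L2Torus) ∧
      (∀ Φ₀ : L2Torus, Φ₀ ≠ 0 → 0 < (inner ℂ (S Φ₀) Φ₀).re) := by
  obtain ⟨S, hS⟩ := exists_equiv_coe_eq_humOp hω hne hT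
  have hSa : ∀ u, S u = humOp ω hω T u := fun u => by rw [← hS]; rfl
  refine ⟨fun u₀ u₁ => ?_, S, fun f => ?_, fun Φ Ψ h => ?_, ?_, fun f hf => ?_⟩
  -- This f solves u₀ - iSf = U(-T)u₁, which Duhamel's formula carries to u₁ at time T.
  · set f := S.symm (Complex.I • (freeProp (-T) u₁ - u₀)) with hf
    have hgc := continuous_observed ω hω f
    have hsol := isSchrodingerSolution_duhamel T u₀ hgc
    refine ⟨fun s => restrictTo ω hω (freeProp s f), ?_, ?_,
      duhamel u₀ fun s => restrictTo ω hω (freeProp s f), hsol, duhamel_zero _ _, ?_,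
      fun v hv hv0 => hv.eqOn hsol (fun _ _ => rfl) (hv0.trans (duhamel_zero _ _).symm)⟩
    · refine memLp_top_of_bound hgc.aestronglyMeasurable ‖f‖ (Filter.Eventually.of_forall fun s => ?_)
      exact (norm_restrictTo_le ω hω _).trans (LinearIsometryEquiv.norm_map _ _).le
    · refine Filter.Eventually.of_forall fun t => ?_
      filter_upwards [restrictTo_ae_eq ω hω (freeProp t f)] with x hx hxω
      rw [hx, indicator_of_notMem hxω]
    · rw [duhamel_observed, ← hSa, hf, ContinuousLinearEquiv.apply_symm_apply, smul_smul,
        Complex.I_mul_I, neg_one_smul, sub_neg_eq_add, add_sub_cancel, freeProp_freeProp_neg]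
  · exact ⟨_, _, isDualControlPair_duhamel ω hω T f, freeProp_zero f⟩
  · rw [hSa, h.humOp_eq hT.le]
  · rw [hS, ContinuousLinearMap.isSelfAdjoint_iff_isSymmetric]
    exact isSymmetric_humOp ω hω T
  · obtain ⟨c, hc, hobs⟩ := exists_observability hω hne hT
    rw [hSa, inner_humOp_self, Complex.ofReal_re]
    have : 0 < ‖f‖ := norm_pos_iff.mpr hf
    exact lt_of_lt_of_le (by positivity) (hobs f)
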